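/- **Conventions.** Let $\nu,d$ be natural numbers and let $\mathbb T=[-\pi,\pi)^\nu$ be the torus (opposite faces of the cube identified), with its Borel $\sigma$-algebra and $-A=\{-x:\ x\in A\}$ formed on the torus. Identities between random variables are meant almost surely. A *matrix valued spectral measure* is a matrix $G=(G_{j,j'})_{1\le j,j'\le d}$ of complex measures on $\mathbb T$ (of finite total variation) which is *positive semidefinite*, i.e. there is a finite measure $\mu$ with $G_{j,j'}\ll\mu$ for all $j,j'$ such that the matrix $\big(\frac{dG_{j,j'}}{d\mu}(x)\big)_{j,j'}$ is positive semidefinite for $\mu$-almost all $x$, and *even*, i.e. $G_{j,j'}(-A)=\overline{G_{j,j'}(A)}$ for all Borel sets $A$. Then each $G_{j,j}$ is a finite positive measure; put $\mathcal K_j=\{u:\mathbb T\to\mathbb C\ \text{measurable}:\ \int|u|^2\,dG_{j,j}<\infty\}$. A *vector valued random spectral measure corresponding to $G$* is a family $Z_G=(Z_{G,1},\dots,Z_{G,d})$ of complex random variables $Z_{G,j}(A)$ ($1\le j\le d$, $A\subset\mathbb T$ Borel) on a probability space such that, for all $j,j'$ and Borel sets, 1. (i) the real and imaginary parts of any finitely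 many of the variables $Z_{G,j}(A)$ are jointly Gaussian; 2. (ii) $E Z_{G,j}(A)=0$; 3. (iii) $E Z_{G,j}(A)\overline{Z_{G,j'}(B)}=G_{j,j'}(A\cap B)$; 4. (iv) $\sum_{s=1}^n Z_{G,j}(A_s)=Z_{G,j}\big(\bigcup_{s=1}^n A_s\big)$ for disjoint $A_1,\dots,A_n$; 5. (v) $Z_{G,j}(A)=\overline{Z_{G,j}(-A)}$. For $u\in\mathcal K_j$ the *random integral* $\int u(x)\,Z_{G,j}(dx)$ is the extension by $L^2$-continuity of $\int\big(\sum_s c_s\mathbb I_{A_s}(x)\big)Z_{G,j}(dx)=\sum_s c_sZ_{G,j}(A_s)$ ($A_s$ disjoint, finite sum): it is the $L^2(P)$-limit of the integrals of elementary functions which converge to $u$ in $L^2(G_{j,j})$. A *stationary Gaussian field* is a family $X=(X_1(p),\dots,X_d(p))$, $p\in\mathbb Z^\nu$, of real random vectors whose coordinates are jointly Gaussian with expectation zero and whose joint distribution is invariant under all shifts $p\mapsto p+m$, $m\in\mathbb Z^\nu$. The matrix valued spectral measure $G$ *is the spectral measure of $X$* if $E X_j(p)X_{j'}(q)=\int_{\mathbb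 T} e^{i(p-q,x)}\,G_{j,j'}(dx)$ for all $j,j'$ and $p,q\in\mathbb Z^\nu$. In that case $T_j$ denotes the extension by $L^2$-continuity, from $L^2(G_{j,j})$ to $L^2(P)$, of the map $\sum_p c_pe^{i(p,x)}\mapsto\sum_p c_pX_j(p)$ (finite sums, complex $c_p$). **Theorem 3.1.** Let $G=(G_{j,j'})_{1\le j,j'\le d}$ be a positive semidefinite matrix valued, even measure on $\mathbb T$. 1. There exists, on some probability space, a vector valued random spectral measure $Z_G$ corresponding to $G$. 2. Let $Z_G$ be any vector valued random spectral measure corresponding to $G$. The random integral $\int u\,dZ_{G,j}$ is well defined (it exists and is almost surely unique) for all $1\le j\le d$ and $u\in\mathcal K_j$, has finite second moment, takes the prescribed values at elementary functions, is linear in $u$, and satisfies: - for $u\in\mathcal K_j$ and $v\in\mathcal K_{j'}$ the function $u\bar v$ is integrable with respect to $G_{j,j'}$, and $$E\Big(\int u(x)\,Z_{G,j}(dx)\ \overline{\int v(x)\,Z_{G,j'}(dx)}\Big)=\int u(x)\overline{v(x)}\,G_{j,j'}(dx);$$ - $E\int u(x)\,Z_{G,j}(dx)=0$ for $u\in\mathcal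 K_j$; - $\int u(x)\,Z_{G,j}(dx)$ is real valued if $u\in\mathcal K_j$ and $u(-x)=\overline{u(x)}$ for $G_{j,j}$-almost all $x$. The formula $$X_j(p)=\int_{\mathbb T}e^{i(p,x)}\,Z_{G,j}(dx),\qquad 1\le j\le d,\ p\in\mathbb Z^\nu,\tag{$*$}$$ defines a (real valued) $d$-dimensional stationary Gaussian field with spectral measure $G$. 3. Let $X$ be any $d$-dimensional stationary Gaussian field with spectral measure $G$. Then the operators $T_j$ are well defined on $L^2(G_{j,j})$, the variables $Z_{G,j}(A)=T_j(\mathbb I_A)$ form a vector valued random spectral measure corresponding to $G$, and with this $Z_G$ formula $(*)$ holds for the given field $X$. -/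

import Mathlib

open MeasureTheory ProbabilityTheory Filter Topology
open scoped Pointwise ComplexConjugate ComplexOrder ENNReal

namespace SpectralField

noncomputable section

/-- The torus `[-π, π)^ν`, opposite faces of the cube being identified. It carries the Borel
σ-algebra, and `-A` is formed in the group of the torus. -/
abbrev Torus (ν : ℕ) : Type := Fin ν → AddCircle (2 * Real.pi)

/-- The character `x ↦ e^{i(p,x)}` of the torus, for `p ∈ ℤ^ν`. -/
def torusChar {ν : ℕ} (p : Fin ν → ℤ) (x : Torus ν) : ℂ := ∏ k, fourier (p k) (x k)

theorem torusChar_coe {ν : ℕ} (p : Fin ν → ℤ) (x : Fin ν → ℝ) :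
    torusChar p (fun k => (x k : AddCircle (2 * Real.pi))) =
      Complex.exp (Complex.I * ((∑ k, (p k : ℝ) * x k : ℝ) : ℂ)) := by
  have h2 : (Real.pi : ℂ) ≠ 0 := by exact_mod_cast Real.pi_ne_zero
  simp only [torusChar, fourier_coe_apply]
  rw [← Complex.exp_sum]
  congr 1
  push_cast
  rw [Finset.mul_sum]
  refine Finset.sum_congr rfl fun k _ => ?_
  field_simp

/-! ### Matrix valued spectral measures -/

/-- A `d × d` matrix of complex measures on the torus. (A complex measure is a `σ`-additive
complex valued set function; it automatically has finite total variation.) -/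
abbrev MatrixMeasure (ν d : ℕ) : Type := Fin d → Fin d → ComplexMeasure (Torus ν)

/-- `G` is positive semidefinite: for some finite measure `μ` all entries `G j j'` are absolutely
continuous with respect to `μ`, i.e. `G j j' (A) = ∫_A g j j' dμ`, and the matrix
`(g j j' (x))` of the Radon–Nikodym derivatives is positive semidefinite for `μ`-almost all `x`. -/
def IsPosSemidefMeasure {ν d : ℕ} (G : MatrixMeasure ν d) : Prop :=
  ∃ μ : Measure (Torus ν), IsFiniteMeasure μ ∧
    ∃ g : Torus ν → Matrix (Fin d) (Fin d) ℂ,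
      (∀ j j', Integrable (fun x => g x j j') μ ∧
        G j j' = μ.withDensityᵥ (fun x => g x j j')) ∧
      ∀ᵐ x ∂μ, (g x).PosSemidef

/-- `G` is even: `G j j' (-A) = conj (G j j' (A))`. -/
def IsEvenMeasure {ν d : ℕ} (G : MatrixMeasure ν d) : Prop :=
  ∀ j j', ∀ A : Set (Torus ν), MeasurableSet A → G j j' (-A) = conj (G j j' A)

/-- A matrix valued spectral measure: a positive semidefinite matrix valued, even measure. -/
structure IsMatrixSpectralMeasure {ν d : ℕ} (G : MatrixMeasure ν d) : Prop where
  posSemidef : IsPosSemidefMeasure G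
  even : IsEvenMeasure G

/-- The diagonal entry `G j j` as a measure: its total variation, which is `G j j` itself
when `G` is positive semidefinite (see `diagMeasure_real`). -/
def diagMeasure {ν d : ℕ} (G : MatrixMeasure ν d) (j : Fin d) : Measure (Torus ν) :=
  (G j j).variation

theorem diagMeasure_real {ν d : ℕ} {G : MatrixMeasure ν d} (hG : IsPosSemidefMeasure G)
    (j : Fin d) {A : Set (Torus ν)} (hA : MeasurableSet A) :
    (((diagMeasure G j).real A : ℝ) : ℂ) = G j j A := by
  obtain ⟨μ, hμ, g, hg, hpos⟩ := hG
  obtain ⟨hi, hd⟩ := hg j j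
  have hnn : ∀ᵐ x ∂μ, g x j j = ((‖g x j j‖ : ℝ) : ℂ) := by
    filter_upwards [hpos] with x hx
    exact (Complex.norm_of_nonneg' hx.diag_nonneg).symm
  have h1 : G j j A = ∫ x in A, ((‖g x j j‖ : ℝ) : ℂ) ∂μ := by
    rw [hd, withDensityᵥ_apply hi hA]
    exact setIntegral_congr_ae hA (hnn.mono fun x hx _ => hx)
  have h2 : (diagMeasure G j).real A = ∫ x in A, ‖g x j j‖ ∂μ := by
    rw [diagMeasure, hd, Measure.variation_withDensityᵥ hi, Measure.real, withDensity_apply _ hA,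
      integral_norm_eq_lintegral_enorm hi.aestronglyMeasurable.restrict]
  rw [h1, h2, integral_complex_ofReal]

/-- The integral `∫ f dκ` of a complex function with respect to a complex measure. -/
def cintegral {ν : ℕ} (κ : ComplexMeasure (Torus ν)) (f : Torus ν → ℂ) : ℂ :=
  κ.integral f (ContinuousLinearMap.mul ℝ ℂ)

/-! ### Vector valued random spectral measures -/

/-- `Z` is a `d`-dimensional vector valued random spectral measure corresponding to `G`, on the
probability space `(Ω, P)`. Only the values of `Z j` at Borel sets matter; identities between
random variables are understood almost surely. In `gaussian`, `ℂ` is regarded as a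
two-dimensional real space, so that the condition says that the real and imaginary parts of
finitely many of the variables `Z j A` are jointly Gaussian (possibly degenerate). -/
structure IsRandomSpectralMeasure {ν d : ℕ} {Ω : Type*} [MeasurableSpace Ω] (P : Measure Ω)
    (G : MatrixMeasure ν d) (Z : Fin d → Set (Torus ν) → Ω → ℂ) : Prop where
  gaussian : IsGaussianProcess
    (fun (t : Fin d × {A : Set (Torus ν) // MeasurableSet A}) ω => Z t.1 t.2.1 ω) P
  mean_zero : ∀ j A, MeasurableSet A → ∫ ω, Z j A ω ∂P = 0
  covariance : ∀ j j' A B, MeasurableSet A → MeasurableSet B →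
    ∫ ω, Z j A ω * conj (Z j' B ω) ∂P = G j j' (A ∩ B)
  additive : ∀ (j : Fin d) (n : ℕ) (A : Fin n → Set (Torus ν)), (∀ s, MeasurableSet (A s)) →
    Pairwise (fun s t => Disjoint (A s) (A t)) →
    (fun ω => ∑ s, Z j (A s) ω) =ᵐ[P] Z j (⋃ s, A s)
  hermitian : ∀ j A, MeasurableSet A → Z j A =ᵐ[P] fun ω => conj (Z j (-A) ω)

/-! ### Extension by continuity in `L²` -/

/-- Given functions `φ i` on `α` and random variables `Φ i`, `ξ` is a value at `u` of the
extension by `L²`-continuity of the assignment `φ i ↦ Φ i`: there is a sequence `i_n` with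
`φ (i_n) → u` in `L²(m)` and `Φ (i_n) → ξ` in `L²(P)`. -/
def IsL2Extension {α ι Ω : Type*} [MeasurableSpace α] [MeasurableSpace Ω]
    (m : Measure α) (P : Measure Ω) (φ : ι → α → ℂ) (Φ : ι → Ω → ℂ)
    (u : α → ℂ) (ξ : Ω → ℂ) : Prop :=
  MemLp ξ 2 P ∧ ∃ i : ℕ → ι,
    Tendsto (fun n => eLpNorm (fun x => φ (i n) x - u x) 2 m) atTop (𝓝 0) ∧
    Tendsto (fun n => eLpNorm (fun ω => Φ (i n) ω - ξ ω) 2 P) atTop (𝓝 0)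

open Classical in
/-- A version of the extension by `L²`-continuity (and `0` where there is no extension). -/
def l2Extension {α ι Ω : Type*} [MeasurableSpace α] [MeasurableSpace Ω]
    (m : Measure α) (P : Measure Ω) (φ : ι → α → ℂ) (Φ : ι → Ω → ℂ) (u : α → ℂ) : Ω → ℂ :=
  if h : ∃ ξ, IsL2Extension m P φ Φ u ξ then h.choose else 0

/-- The extension by `L²`-continuity is well defined on `L²(m)`: at every `u` in `L²(m)` it has
a value, and any two values agree almost surely. -/
def L2ExtensionWellDefined {α ι Ω : Type*} [MeasurableSpace α] [MeasurableSpace Ω]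
    (m : Measure α) (P : Measure Ω) (φ : ι → α → ℂ) (Φ : ι → Ω → ℂ) : Prop :=
  ∀ u : α → ℂ, MemLp u 2 m →
    (∃ ξ, IsL2Extension m P φ Φ u ξ) ∧
    ∀ ξ ξ', IsL2Extension m P φ Φ u ξ → IsL2Extension m P φ Φ u ξ' → ξ =ᵐ[P] ξ'

/-! ### Random integrals -/

/-- The integral `∑ c Z_j({s = c})` of an elementary function `s`, i.e. of a finite linear
combination of indicator functions of disjoint Borel sets. -/
def elementaryIntegral {ν d : ℕ} {Ω : Type*} (Z : Fin d → Set (Torus ν) → Ω → ℂ) (j : Fin d)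
    (s : SimpleFunc (Torus ν) ℂ) (ω : Ω) : ℂ :=
  ∑ c ∈ s.range, c * Z j (s ⁻¹' {c}) ω

/-- The random integral `∫ u(x) Z_{G,j}(dx)`, for `u` with `∫ |u|² dG_{j,j} < ∞`: the extension by
`L²`-continuity of the integral of elementary functions. -/
def randomIntegral {ν d : ℕ} {Ω : Type*} [MeasurableSpace Ω] (P : Measure Ω)
    (G : MatrixMeasure ν d) (Z : Fin d → Set (Torus ν) → Ω → ℂ) (j : Fin d)
    (u : Torus ν → ℂ) : Ω → ℂ :=
  l2Extension (diagMeasure G j) P (fun (s : SimpleFunc (Torus ν) ℂ) x => s x)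
    (elementaryIntegral Z j) u

/-! ### Stationary Gaussian vector fields -/

/-- `X = (X_1(p), …, X_d(p))`, `p ∈ ℤ^ν`, is a `d`-dimensional real Gaussian stationary random
field with expectation zero; `X j p` is the `j`-th coordinate at `p`. -/
structure IsStationaryGaussianField {ν d : ℕ} {Ω : Type*} [MeasurableSpace Ω] (P : Measure Ω)
    (X : Fin d → (Fin ν → ℤ) → Ω → ℝ) : Prop where
  gaussian : IsGaussianProcess (fun (t : Fin d × (Fin ν → ℤ)) ω => X t.1 t.2 ω) P
  mean_zero : ∀ j p, ∫ ω, X j p ω ∂P = 0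
  stationary : ∀ m : Fin ν → ℤ,
    IdentDistrib (fun ω (t : Fin d × (Fin ν → ℤ)) => X t.1 (t.2 + m) ω)
      (fun ω (t : Fin d × (Fin ν → ℤ)) => X t.1 t.2 ω) P P

/-- `G` is the matrix valued spectral measure of the field `X`:
`E X_j(p) X_{j'}(q) = ∫ e^{i(p-q,x)} G_{j,j'}(dx)`. -/
def HasSpectralMeasure {ν d : ℕ} {Ω : Type*} [MeasurableSpace Ω] (P : Measure Ω)
    (X : Fin d → (Fin ν → ℤ) → Ω → ℝ) (G : MatrixMeasure ν d) : Prop :=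
  IsMatrixSpectralMeasure G ∧
  ∀ j j' p q, ((∫ ω, X j p ω * X j' q ω ∂P : ℝ) : ℂ) = cintegral (G j j') (torusChar (p - q))

/-- The trigonometric polynomial `∑ c_p e^{i(p,x)}`. -/
def trigPoly {ν : ℕ} (c : (Fin ν → ℤ) →₀ ℂ) (x : Torus ν) : ℂ :=
  c.sum fun p a => a * torusChar p x

/-- The linear combination `∑ c_p X_j(p)`. -/
def fieldComb {ν d : ℕ} {Ω : Type*} (X : Fin d → (Fin ν → ℤ) → Ω → ℝ) (j : Fin d)
    (c : (Fin ν → ℤ) →₀ ℂ) (ω : Ω) : ℂ :=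
  c.sum fun p a => a * (X j p ω : ℂ)

/-- The operator `T_j` from `L²(G_{j,j})` to `L²(P)`: the extension by `L²`-continuity of
`∑ c_p e^{i(p,x)} ↦ ∑ c_p X_j(p)`. -/
def spectralOperator {ν d : ℕ} {Ω : Type*} [MeasurableSpace Ω] (P : Measure Ω)
    (G : MatrixMeasure ν d) (X : Fin d → (Fin ν → ℤ) → Ω → ℝ) (j : Fin d)
    (u : Torus ν → ℂ) : Ω → ℂ :=
  l2Extension (diagMeasure G j) P trigPoly (fieldComb X j) u

/-- The random spectral measure `Z_{G,j}(A) = T_j(𝟙_A)` constructed from the field `X`. -/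
def constructedMeasure {ν d : ℕ} {Ω : Type*} [MeasurableSpace Ω] (P : Measure Ω)
    (G : MatrixMeasure ν d) (X : Fin d → (Fin ν → ℤ) → Ω → ℝ) (j : Fin d)
    (A : Set (Torus ν)) : Ω → ℂ :=
  spectralOperator P G X j (A.indicator fun _ => 1)

end

end SpectralField

open SpectralField

namespace SpectralField

/-! ### Inner products and limits in `L²` -/

section L2

variable {α Ω : Type*} [MeasurableSpace α] [MeasurableSpace Ω] {m : Measure α} {P : Measure Ω}

variable {𝕜 : Type*} [RCLike 𝕜]

/-! Everything rests on one principle: an assignment that preserves inner products extends from a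
dense family to all of L², and the extension inherits whatever passes to L² limits or can be read
off Gram matrices. Two such assignments occur. For a given `Z` it sends elementary functions to
their integrals; for a given field it sends trigonometric polynomials to combinations of the `X j
p`. In both cases the covariances are `∫ φ conj φ' dG_{j,j'}`, which is what `IsSpectralIsometry`
records, for all pairs `j, j'`. The diagonal case gives an isometry and hence the extension. The
off-diagonal forms extend because the 2×2 minors of the density satisfy `|g_{jj'}|² ≤ g_{jj}
g_{j'j'}`, so they are continuous on L²(G_{jj}) × L²(G_{j'j'}) (`tendsto_spectralForm`). Linearity
holds because the squared norm of `T(au+bv) - aT(u) - bT(v)` is a Gram expression, equal to that of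
the zero function. Means, Gaussianity and the conjugation symmetry survive limits; for the last one
evenness makes `u ↦ conj u(-·)` an isometry. Stationarity of the integrals of the characters follows
since their covariances depend only on `p - q` and determine a centered Gaussian law. Conversely,
trigonometric polynomials are dense by Stone–Weierstrass, so a field yields operators `T_j`;
integration against `T_j 𝟙_A` agrees with `T_j` on elementary functions, hence everywhere, in
particular at characters. For existence, `G_{jj'}(A ∩ B)` is a positive semidefinite kernel, so it
is a Gram matrix in a complex Hilbert space. The real isonormal process of that space, evaluated at
suitable symmetric and antisymmetric combinations, gives a complex Gaussian family with these
covariances and `Z(A) = conj Z(-A)` (`exists_gaussian_of_conj_gram`). Finite additivity is again a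
Gram computation. -/

theorem inner_toLp_eq_integral {f g : α → 𝕜} (hf : MemLp f 2 m) (hg : MemLp g 2 m) :
    inner 𝕜 (hg.toLp g) (hf.toLp f) = ∫ x, f x * conj (g x) ∂m := by
  rw [L2.inner_def]
  refine integral_congr_ae ?_
  filter_upwards [hf.coeFn_toLp, hg.coeFn_toLp] with x h1 h2
  rw [h1, h2, RCLike.inner_apply]

theorem integrable_mul_conj {f g : α → 𝕜} (hf : MemLp f 2 m) (hg : MemLp g 2 m) :
    Integrable (fun x => f x * conj (g x)) m :=
  hf.integrable_mul hg.star

theorem tendsto_toLp_of_tendsto_eLpNorm {f : α → 𝕜} {F : ℕ → α → 𝕜} (hf : MemLp f 2 m)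
    (hF : ∀ n, MemLp (F n) 2 m)
    (h : Tendsto (fun n => eLpNorm (fun x => F n x - f x) 2 m) atTop (𝓝 0)) :
    Tendsto (fun n => (hF n).toLp (F n)) atTop (𝓝 (hf.toLp f)) :=
  (Lp.tendsto_Lp_iff_tendsto_eLpNorm'' F hF f hf).2 h

theorem tendsto_integral_mul_conj {f g : α → 𝕜} {F H : ℕ → α → 𝕜} (hf : MemLp f 2 m)
    (hg : MemLp g 2 m) (hF : ∀ n, MemLp (F n) 2 m) (hH : ∀ n, MemLp (H n) 2 m)
    (hFf : Tendsto (fun n => eLpNorm (fun x => F n x - f x) 2 m) atTop (𝓝 0))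
    (hHg : Tendsto (fun n => eLpNorm (fun x => H n x - g x) 2 m) atTop (𝓝 0)) :
    Tendsto (fun n => ∫ x, F n x * conj (H n x) ∂m) atTop (𝓝 (∫ x, f x * conj (g x) ∂m)) := by
  have h := (tendsto_toLp_of_tendsto_eLpNorm hg hH hHg).inner (𝕜 := 𝕜)
    (tendsto_toLp_of_tendsto_eLpNorm hf hF hFf)
  simpa only [inner_toLp_eq_integral] using h

theorem MemLp.finset_sum_mul {ι : Type*} (s : Finset ι) (c : ι → ℂ) {x : ι → α → ℂ}
    (hx : ∀ i, MemLp (x i) 2 m) : MemLp (fun t => ∑ i ∈ s, c i * x i t) 2 m :=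
  memLp_finsetSum s fun i _ => (hx i).const_mul (c i)

theorem toLp_finset_sum_mul {ι : Type*} (s : Finset ι) (c : ι → ℂ) {x : ι → α → ℂ}
    (hx : ∀ i, MemLp (x i) 2 m) :
    (MemLp.finset_sum_mul s c hx).toLp _ = ∑ i ∈ s, c i • (hx i).toLp (x i) := by
  classical
  induction s using Finset.induction_on with
  | empty =>
    simp only [Finset.sum_empty]
    exact MemLp.toLp_zero _
  | insert a s ha ih =>
    rw [Finset.sum_insert ha, ← ih, ← MemLp.toLp_const_smul, ← MemLp.toLp_add]
    refine MemLp.toLp_congr _ _ (Eventually.of_forall fun t => ?_)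
    simp [Finset.sum_insert ha]

/-- Two families with the same Gram matrix have linear combinations of the same norms. -/
theorem eLpNorm_sum_eq_of_gram {ι : Type*} (s : Finset ι) (c : ι → ℂ) {x : ι → α → ℂ}
    {ξ : ι → Ω → ℂ} (hx : ∀ i, MemLp (x i) 2 m) (hξ : ∀ i, MemLp (ξ i) 2 P)
    (h : ∀ i k, ∫ ω, ξ i ω * conj (ξ k ω) ∂P = ∫ t, x i t * conj (x k t) ∂m) :
    eLpNorm (fun ω => ∑ i ∈ s, c i * ξ i ω) 2 P = eLpNorm (fun t => ∑ i ∈ s, c i * x i t) 2 m := by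
  have h1 := Lp.nnnorm_toLp _ (MemLp.finset_sum_mul s c hx)
  have h2 := Lp.nnnorm_toLp _ (MemLp.finset_sum_mul s c hξ)
  -- The squared norm of a combination is a form in the coefficients whose matrix is the Gram
  -- matrix.
  have h3 : ‖(MemLp.finset_sum_mul s c hξ).toLp _‖ = ‖(MemLp.finset_sum_mul s c hx).toLp _‖ := by
    rw [norm_eq_sqrt_re_inner (𝕜 := ℂ), norm_eq_sqrt_re_inner (𝕜 := ℂ),
      toLp_finset_sum_mul s c hξ, toLp_finset_sum_mul s c hx]
    simp only [sum_inner, inner_sum, inner_smul_left, inner_smul_right, inner_toLp_eq_integral, h]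
  have h4 : ‖(MemLp.finset_sum_mul s c hξ).toLp _‖₊ = ‖(MemLp.finset_sum_mul s c hx).toLp _‖₊ :=
    NNReal.eq h3
  rw [h1, h2] at h4
  exact (ENNReal.toNNReal_eq_toNNReal_iff' (MemLp.finset_sum_mul s c hξ).eLpNorm_ne_top
    (MemLp.finset_sum_mul s c hx).eLpNorm_ne_top).1 h4

theorem eLpNorm_sub_eq_of_gram {x : Fin 2 → α → ℂ} {ξ : Fin 2 → Ω → ℂ}
    (hx : ∀ i, MemLp (x i) 2 m) (hξ : ∀ i, MemLp (ξ i) 2 P)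
    (h : ∀ i k, ∫ ω, ξ i ω * conj (ξ k ω) ∂P = ∫ t, x i t * conj (x k t) ∂m) :
    eLpNorm (fun ω => ξ 0 ω - ξ 1 ω) 2 P = eLpNorm (fun t => x 0 t - x 1 t) 2 m := by
  simpa [Fin.sum_univ_two, sub_eq_add_neg] using
    eLpNorm_sum_eq_of_gram Finset.univ ![1, -1] hx hξ h

theorem ae_eq_of_eLpNorm_sub_eq_zero {f g : Ω → ℂ} (hf : MemLp f 2 P) (hg : MemLp g 2 P)
    (h : eLpNorm (fun ω => f ω - g ω) 2 P = 0) : f =ᵐ[P] g := by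
  replace h := (eLpNorm_eq_zero_iff (hf.sub hg).aestronglyMeasurable (by simp)).1 h
  filter_upwards [h] with ω hω
  exact sub_eq_zero.1 hω

theorem ae_eq_of_tendsto_eLpNorm {f g : Ω → ℂ} {F : ℕ → Ω → ℂ} (hf : MemLp f 2 P)
    (hg : MemLp g 2 P) (hF : ∀ n, MemLp (F n) 2 P)
    (h1 : Tendsto (fun n => eLpNorm (fun x => F n x - f x) 2 P) atTop (𝓝 0))
    (h2 : Tendsto (fun n => eLpNorm (fun x => F n x - g x) 2 P) atTop (𝓝 0)) : f =ᵐ[P] g := by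
  have := tendsto_nhds_unique (tendsto_toLp_of_tendsto_eLpNorm hf hF h1)
    (tendsto_toLp_of_tendsto_eLpNorm hg hF h2)
  exact (MemLp.toLp_eq_toLp_iff hf hg).1 this

theorem tendsto_eLpNorm_sub_zero_of_ae_eq {f : Ω → ℂ} {F : ℕ → Ω → ℂ} (h : ∀ n, F n =ᵐ[P] f) :
    Tendsto (fun n => eLpNorm (fun x => F n x - f x) 2 P) atTop (𝓝 0) := by
  have : (fun n => eLpNorm (fun x => F n x - f x) 2 P) = fun _ => 0 := by
    funext n
    rw [eLpNorm_congr_ae (g := fun _ => (0 : ℂ))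
      ((h n).mono fun x hx => by simp [hx])]
    simp
  rw [this]
  exact tendsto_const_nhds

end L2

/-! ### Extension by continuity of maps that preserve inner products -/

/-- `Φ i` has the same Gram matrix as `φ i`, and the `φ i` are dense in `L²(m)`. -/
structure IsDenseIsometry {α ι Ω : Type*} [MeasurableSpace α] [MeasurableSpace Ω]
    (m : Measure α) (P : Measure Ω) (φ : ι → α → ℂ) (Φ : ι → Ω → ℂ) : Prop where
  memLp_source : ∀ i, MemLp (φ i) 2 m
  memLp_target : ∀ i, MemLp (Φ i) 2 P
  gram : ∀ i k, ∫ ω, Φ i ω * conj (Φ k ω) ∂P = ∫ x, φ i x * conj (φ k x) ∂m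
  dense : ∀ u, MemLp u 2 m → ∀ ε : ℝ≥0∞, ε ≠ 0 → ∃ i, eLpNorm (fun x => φ i x - u x) 2 m < ε

namespace IsDenseIsometry

variable {α ι Ω : Type*} [MeasurableSpace α] [MeasurableSpace Ω] {m : Measure α} {P : Measure Ω}
  {φ : ι → α → ℂ} {Φ : ι → Ω → ℂ}

theorem eLpNorm_sub (h : IsDenseIsometry m P φ Φ) (i k : ι) :
    eLpNorm (fun ω => Φ i ω - Φ k ω) 2 P = eLpNorm (fun x => φ i x - φ k x) 2 m :=
  eLpNorm_sub_eq_of_gram (x := fun t => φ (![i, k] t)) (ξ := fun t => Φ (![i, k] t))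
    (fun _ => h.memLp_source _) (fun _ => h.memLp_target _) fun _ _ => h.gram _ _

theorem exists_seq (h : IsDenseIsometry m P φ Φ) {u : α → ℂ} (hu : MemLp u 2 m) :
    ∃ i : ℕ → ι, Tendsto (fun n => eLpNorm (fun x => φ (i n) x - u x) 2 m) atTop (𝓝 0) := by
  choose i hi using fun n : ℕ => h.dense u hu ((n : ℝ≥0∞) + 1)⁻¹ (by simp)
  refine ⟨i, tendsto_of_tendsto_of_tendsto_of_le_of_le tendsto_const_nhds ?_ (fun _ => zero_le)
    fun n => (hi n).le⟩
  have := (tendsto_add_atTop_iff_nat 1).2 ENNReal.tendsto_inv_nat_nhds_zero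
  simpa using this

/-- An approximating sequence of `u` is Cauchy, its image has the same mutual distances, and L²(P)
is complete. -/
theorem exists_isL2Extension (h : IsDenseIsometry m P φ Φ) {u : α → ℂ} (hu : MemLp u 2 m) :
    ∃ ξ, IsL2Extension m P φ Φ u ξ := by
  obtain ⟨i, hi⟩ := h.exists_seq hu
  have hc := (tendsto_toLp_of_tendsto_eLpNorm hu (fun n => h.memLp_source (i n)) hi).cauchySeq
  have hd : CauchySeq fun n => (h.memLp_target (i n)).toLp (Φ (i n)) := by
    rw [EMetric.cauchySeq_iff] at hc ⊢
    intro ε hε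
    obtain ⟨N, hN⟩ := hc ε hε
    refine ⟨N, fun a ha b hb => ?_⟩
    have := hN a ha b hb
    rw [Lp.edist_toLp_toLp] at this ⊢
    exact (h.eLpNorm_sub (i a) (i b)).trans_lt this
  obtain ⟨ξ, hξ⟩ := cauchySeq_tendsto_of_complete hd
  refine ⟨ξ, Lp.memLp ξ, i, hi, ?_⟩
  exact (Lp.tendsto_Lp_iff_tendsto_eLpNorm'' _ (fun n => h.memLp_target (i n)) ξ (Lp.memLp ξ)).1
    (by simpa using hξ)

/-- Two sequences approximating the same `u` approach each other, and so do their images. Only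
distances are compared, so the index type needs no linear structure. -/
theorem isL2Extension_unique (h : IsDenseIsometry m P φ Φ) {u : α → ℂ} (hu : MemLp u 2 m)
    {ξ ξ' : Ω → ℂ} (h1 : IsL2Extension m P φ Φ u ξ) (h2 : IsL2Extension m P φ Φ u ξ') :
    ξ =ᵐ[P] ξ' := by
  obtain ⟨hm, i, hi, hi'⟩ := h1
  obtain ⟨hm', k, hk, hk'⟩ := h2
  refine ae_eq_of_tendsto_eLpNorm hm hm' (fun n => h.memLp_target (i n)) hi' ?_
  refine tendsto_of_tendsto_of_tendsto_of_le_of_le tendsto_const_nhds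
    (h := fun n => (eLpNorm (fun x => φ (i n) x - u x) 2 m +
      eLpNorm (fun x => φ (k n) x - u x) 2 m) + eLpNorm (fun ω => Φ (k n) ω - ξ' ω) 2 P)
    (by simpa using (hi.add hk).add hk') (fun _ => zero_le) fun n => ?_
  have e1 : (fun ω => Φ (i n) ω - ξ' ω) =
      (fun ω => Φ (i n) ω - Φ (k n) ω) + fun ω => Φ (k n) ω - ξ' ω := by
    ext; simp
  have e2 : (fun x => φ (i n) x - φ (k n) x) =
      (fun x => φ (i n) x - u x) - fun x => φ (k n) x - u x := by
    ext; simp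
  dsimp only
  rw [e1]
  refine (eLpNorm_add_le ((h.memLp_target _).sub (h.memLp_target _)).aestronglyMeasurable
    ((h.memLp_target _).sub hm').aestronglyMeasurable (by norm_num)).trans ?_
  refine add_le_add ?_ le_rfl
  refine (h.eLpNorm_sub (i n) (k n)).trans_le ?_
  rw [e2]
  exact eLpNorm_sub_le ((h.memLp_source _).sub hu).aestronglyMeasurable
    ((h.memLp_source _).sub hu).aestronglyMeasurable (by norm_num)

theorem wellDefined (h : IsDenseIsometry m P φ Φ) : L2ExtensionWellDefined m P φ Φ :=
  fun _ hu => ⟨h.exists_isL2Extension hu, fun _ _ => h.isL2Extension_unique hu⟩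

theorem isL2Extension_l2Extension (h : IsDenseIsometry m P φ Φ) {u : α → ℂ} (hu : MemLp u 2 m) :
    IsL2Extension m P φ Φ u (l2Extension m P φ Φ u) := by
  have he := h.exists_isL2Extension hu
  rw [l2Extension, dif_pos he]
  exact he.choose_spec

theorem memLp_l2Extension (h : IsDenseIsometry m P φ Φ) {u : α → ℂ} (hu : MemLp u 2 m) :
    MemLp (l2Extension m P φ Φ u) 2 P :=
  (h.isL2Extension_l2Extension hu).1

theorem l2Extension_ae_eq (h : IsDenseIsometry m P φ Φ) {u : α → ℂ} (hu : MemLp u 2 m)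
    {ξ : Ω → ℂ} (hξ : IsL2Extension m P φ Φ u ξ) : l2Extension m P φ Φ u =ᵐ[P] ξ :=
  h.isL2Extension_unique hu (h.isL2Extension_l2Extension hu) hξ

theorem l2Extension_apply (h : IsDenseIsometry m P φ Φ) (i : ι) :
    l2Extension m P φ Φ (φ i) =ᵐ[P] Φ i :=
  h.l2Extension_ae_eq (h.memLp_source i) ⟨h.memLp_target i, fun _ => i,
    tendsto_eLpNorm_sub_zero_of_ae_eq fun _ => EventuallyEq.rfl,
    tendsto_eLpNorm_sub_zero_of_ae_eq fun _ => EventuallyEq.rfl⟩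

end IsDenseIsometry

/-! ### Linearity of maps that preserve inner products -/

/-- `T` maps `L²(m)` to `L²(P)` and preserves inner products. -/
structure IsL2Isometry {α Ω : Type*} [MeasurableSpace α] [MeasurableSpace Ω]
    (m : Measure α) (P : Measure Ω) (T : (α → ℂ) → Ω → ℂ) : Prop where
  memLp : ∀ u, MemLp u 2 m → MemLp (T u) 2 P
  gram : ∀ u v, MemLp u 2 m → MemLp v 2 m →
    ∫ ω, T u ω * conj (T v ω) ∂P = ∫ x, u x * conj (v x) ∂m

namespace IsL2Isometry

variable {α Ω : Type*} [MeasurableSpace α] [MeasurableSpace Ω] {m : Measure α} {P : Measure Ω}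
  {T : (α → ℂ) → Ω → ℂ}

theorem eLpNorm_sub (h : IsL2Isometry m P T) {u v : α → ℂ} (hu : MemLp u 2 m)
    (hv : MemLp v 2 m) :
    eLpNorm (fun ω => T u ω - T v ω) 2 P = eLpNorm (fun x => u x - v x) 2 m := by
  have hw : ∀ i, MemLp (![u, v] i) 2 m := fun i => by fin_cases i <;> assumption
  exact eLpNorm_sub_eq_of_gram (x := ![u, v]) (ξ := fun t => T (![u, v] t))
    hw (fun _ => h.memLp _ (hw _)) fun _ _ => h.gram _ _ (hw _) (hw _)

/-- Linearity is a consequence of preserved inner products: the norm of the defect equals that of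
the zero combination `(au+bv) - au - bv`. -/
theorem map_linearComb (h : IsL2Isometry m P T) (a b : ℂ) {u v : α → ℂ} (hu : MemLp u 2 m)
    (hv : MemLp v 2 m) :
    T (fun x => a * u x + b * v x) =ᵐ[P] fun ω => a * T u ω + b * T v ω := by
  have hc : MemLp (fun x => a * u x + b * v x) 2 m := (hu.const_mul a).add (hv.const_mul b)
  have hw : ∀ i, MemLp (![fun x => a * u x + b * v x, u, v] i) 2 m :=
    fun i => by fin_cases i <;> assumption
  have key := eLpNorm_sum_eq_of_gram (x := ![fun x => a * u x + b * v x, u, v])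
    (ξ := fun t => T (![fun x => a * u x + b * v x, u, v] t)) Finset.univ ![1, -a, -b]
    hw (fun _ => h.memLp _ (hw _)) fun _ _ => h.gram _ _ (hw _) (hw _)
  refine ae_eq_of_eLpNorm_sub_eq_zero (h.memLp _ hc)
    (((h.memLp _ hu).const_mul a).add ((h.memLp _ hv).const_mul b)) ?_
  have e1 : (fun ω => ∑ i, ![1, -a, -b] i * T (![fun x => a * u x + b * v x, u, v] i) ω) =
      fun ω => T (fun x => a * u x + b * v x) ω - (a * T u ω + b * T v ω) := by
    funext ω
    simp [Fin.sum_univ_three]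
    ring
  have e2 : (fun t => ∑ i, ![1, -a, -b] i * (![fun x => a * u x + b * v x, u, v] i) t) =
      fun _ => (0 : ℂ) := by
    funext t
    simp [Fin.sum_univ_three]
  rw [e1, e2] at key
  rw [key]
  simp

/-- `T` acts on functions rather than on classes; preserved distances make it respect almost
everywhere equality. -/
theorem map_congr (h : IsL2Isometry m P T) {u v : α → ℂ} (hu : MemLp u 2 m) (huv : u =ᵐ[m] v) :
    T u =ᵐ[P] T v := by
  have hv := hu.ae_eq huv
  refine ae_eq_of_eLpNorm_sub_eq_zero (h.memLp _ hu) (h.memLp _ hv) ?_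
  rw [h.eLpNorm_sub hu hv, eLpNorm_congr_ae (g := fun _ => (0 : ℂ))
    (huv.mono fun x hx => by simp [hx])]
  simp

theorem map_sum (h : IsL2Isometry m P T) {ι : Type*} (s : Finset ι) (c : ι → ℂ)
    {u : ι → α → ℂ} (hu : ∀ i, MemLp (u i) 2 m) :
    T (fun x => ∑ i ∈ s, c i * u i x) =ᵐ[P] fun ω => ∑ i ∈ s, c i * T (u i) ω := by
  classical
  induction s using Finset.induction_on with
  | empty =>
    have := h.map_linearComb 0 0 (MemLp.zero' (ε := ℂ)) (MemLp.zero' (ε := ℂ))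
    simpa using this
  | insert a s ha ih =>
    have := h.map_linearComb (c a) 1 (hu a) (MemLp.finset_sum_mul s c hu)
    simp only [one_mul] at this
    simp only [Finset.sum_insert ha]
    filter_upwards [this, ih] with ω h1 h2
    rw [h1, h2]

end IsL2Isometry

/-! ### Gaussian processes: limits and laws -/

section Gaussian

variable {Ω : Type*} [MeasurableSpace Ω] {P : Measure Ω}

/-- The mean is the inner product with the constant 1, which is square integrable for a probability
measure. -/
theorem tendsto_integral_of_tendsto_eLpNorm_two [IsProbabilityMeasure P] {𝕜 : Type*} [RCLike 𝕜]
    {f : Ω → 𝕜} {F : ℕ → Ω → 𝕜} (hf : MemLp f 2 P) (hF : ∀ n, MemLp (F n) 2 P)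
    (h : Tendsto (fun n => eLpNorm (fun x => F n x - f x) 2 P) atTop (𝓝 0)) :
    Tendsto (fun n => ∫ ω, F n ω ∂P) atTop (𝓝 (∫ ω, f ω ∂P)) := by
  have := tendsto_integral_mul_conj (H := fun _ _ => (1 : 𝕜)) hf (memLp_const 1) hF
    (fun _ => memLp_const 1) h (by simp)
  simpa using this

/-- A limit in `L²` of Gaussian random variables is Gaussian. -/
theorem hasGaussianLaw_of_tendsto_eLpNorm {Y : Ω → ℝ} {F : ℕ → Ω → ℝ} (hY : MemLp Y 2 P)
    (hF : ∀ n, HasGaussianLaw (F n) P)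
    (h : Tendsto (fun n => eLpNorm (fun x => F n x - Y x) 2 P) atTop (𝓝 0)) :
    HasGaussianLaw Y P := by
  have hP : IsProbabilityMeasure P := (hF 0).isProbabilityMeasure
  have hF2 : ∀ n, MemLp (F n) 2 P := fun n => (hF n).memLp_two
  have hmean := tendsto_integral_of_tendsto_eLpNorm_two hY hF2 h
  have hsq := tendsto_integral_mul_conj hY hY hF2 hF2 h h
  simp only [conj_trivial] at hsq
  -- Along an almost surely convergent subsequence the characteristic functions converge by
  -- dominated convergence.
  obtain ⟨ns, hns, hae⟩ := (tendstoInMeasure_of_tendsto_eLpNorm (p := 2) (by simp)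
    (fun n => (hF2 n).aestronglyMeasurable) hY.aestronglyMeasurable h).exists_seq_tendsto_ae
  refine (hasGaussianLaw_iff_charFun_map_eq hY.aemeasurable).2 fun t => ?_
  -- The Gaussian characteristic function is a continuous expression in the mean and the second
  -- moment, both of which converge.
  have hform : ∀ X : Ω → ℝ, MemLp X 2 P →
      Complex.exp ((∫ ω, inner ℝ t (X ω) ∂P : ℝ) * Complex.I
        - Var[fun ω => inner ℝ t (X ω); P] / 2) =
      Complex.exp ((t * (∫ ω, X ω ∂P) : ℝ) * Complex.I
        - ((t ^ 2 * (∫ ω, X ω * X ω ∂P - (∫ ω, X ω ∂P) ^ 2) : ℝ) : ℂ) / 2) := by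
    intro X hX
    have e1 : (fun ω => inner ℝ t (X ω)) = fun ω => t * X ω := by
      funext ω
      simp [mul_comm]
    rw [e1, integral_const_mul, variance_const_mul, variance_eq_sub hX]
    simp [pow_two]
  have hlim := fun n => (hF (ns n)).charFun_map_eq t
  simp only [hform _ (hF2 _)] at hlim
  refine Eq.trans ?_ (hform Y hY).symm
  have l1 : Tendsto (fun n => charFun (P.map (F (ns n))) t) atTop (𝓝 (charFun (P.map Y) t)) := by
    have hchar : ∀ X : Ω → ℝ, AEMeasurable X P →
        charFun (P.map X) t = ∫ ω, Complex.exp (t * X ω * Complex.I) ∂P := by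
      intro X hX
      rw [charFun_apply_real, integral_map hX (by fun_prop)]
    rw [hchar Y hY.aemeasurable]
    simp only [fun n => hchar _ (hF2 (ns n)).aemeasurable]
    refine tendsto_integral_of_dominated_convergence (fun _ => 1) (fun n => ?_)
      (integrable_const 1) (fun n => Eventually.of_forall fun ω => ?_) ?_
    · have := (hF2 (ns n)).aestronglyMeasurable.aemeasurable
      exact AEMeasurable.aestronglyMeasurable (by fun_prop)
    · rw [← Complex.ofReal_mul, Complex.norm_exp_ofReal_mul_I]
    · filter_upwards [hae] with ω hω
      refine (Complex.continuous_exp.tendsto _).comp ?_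
      exact (((Complex.continuous_ofReal.tendsto _).comp hω).const_mul _).mul_const _
  refine tendsto_nhds_unique l1 ?_
  simp only [hlim]
  have hm := hmean.comp hns.tendsto_atTop
  have hs := hsq.comp hns.tendsto_atTop
  refine (Complex.continuous_exp.tendsto _).comp ?_
  refine Tendsto.sub (Tendsto.mul_const _ ?_) (Tendsto.div_const ?_ _)
  · exact (Complex.continuous_ofReal.tendsto _).comp (hm.const_mul t)
  · exact (Complex.continuous_ofReal.tendsto _).comp ((hs.sub (hm.pow 2)).const_mul (t ^ 2))

/-- A process whose variables are simultaneously limits in `L²` of the variables of Gaussian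
processes is Gaussian. -/
theorem isGaussianProcess_of_tendsto_eLpNorm {E T : Type*} [NormedAddCommGroup E] [NormedSpace ℝ E]
    [MeasurableSpace E] [BorelSpace E] [SecondCountableTopology E] [CompleteSpace E]
    {X : T → Ω → E} {F : ℕ → T → Ω → E} (hX : ∀ t, MemLp (X t) 2 P)
    (hF : ∀ n, IsGaussianProcess (F n) P)
    (h : ∀ t, Tendsto (fun n => eLpNorm (fun x => F n t x - X t x) 2 P) atTop (𝓝 0)) :
    IsGaussianProcess X P where
  hasGaussianLaw I := by
    classical
    have hR : AEMeasurable (fun ω => I.restrict (X · ω)) P :=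
      aemeasurable_pi_lambda _ fun i => (hX i).aestronglyMeasurable.aemeasurable
    -- A finite-dimensional marginal is Gaussian once all its continuous real functionals are; this
    -- reduces the claim to the scalar lemma.
    refine ⟨isGaussian_of_isGaussian_map fun L => ?_⟩
    rw [AEMeasurable.map_map_of_aemeasurable (by fun_prop) hR]
    suffices H : HasGaussianLaw (L ∘ fun ω => I.restrict (X · ω)) P from H.isGaussian_map
    have hL : ∀ x : I → E, L x = ∑ i, (L ∘L .single ℝ _ i) (x i) := fun x => by
      conv_lhs => rw [← Finset.univ_sum_single x]
      simp
    have hmem : ∀ i : I, MemLp (fun ω => (L ∘L .single ℝ (fun _ : I => E) i) (X i ω)) 2 P :=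
      fun i => ContinuousLinearMap.comp_memLp' _ (hX i)
    have hmemF : ∀ n, ∀ i : I, MemLp (F n i) 2 P :=
      fun n i => ((hF n).hasGaussianLaw_eval i).memLp_two
    refine hasGaussianLaw_of_tendsto_eLpNorm (F := fun n => L ∘ fun ω => I.restrict (F n · ω))
      ?_ (fun n => ((hF n).hasGaussianLaw I).map L) ?_
    · have : (L ∘ fun ω => I.restrict (X · ω)) =
          fun ω => ∑ i, (L ∘L .single ℝ (fun _ : I => E) i) (X i ω) := by
        funext ω
        exact hL _
      rw [this]
      exact memLp_finsetSum _ fun i _ => hmem i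
    -- Splitting `L` into coordinates bounds the error by the sum of the `‖L_i‖` times the
    -- coordinate errors.
    · refine tendsto_of_tendsto_of_tendsto_of_le_of_le tendsto_const_nhds
        (h := fun n => ∑ i : I, ‖L ∘L .single ℝ (fun _ : I => E) i‖ₑ *
          eLpNorm (fun ω => F n i ω - X i ω) 2 P) ?_ (fun _ => zero_le) fun n => ?_
      · have := tendsto_finsetSum (Finset.univ : Finset I) fun i _ =>
          ENNReal.Tendsto.const_mul (a := ‖L ∘L .single ℝ (fun _ : I => E) i‖ₑ) (h i)
            (Or.inr enorm_ne_top)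
        simpa using this
      · have e : (fun ω => (L ∘ fun ω => I.restrict (F n · ω)) ω -
            (L ∘ fun ω => I.restrict (X · ω)) ω) =
            ∑ i : I, fun ω => (L ∘L .single ℝ (fun _ : I => E) i) (F n i ω - X i ω) := by
          funext ω
          simp only [Function.comp_apply, Finset.sum_apply]
          rw [← map_sub, hL]
          rfl
        dsimp only
        rw [e]
        refine (eLpNorm_sum_le (fun i _ => ?_) (by norm_num)).trans (Finset.sum_le_sum fun i _ => ?_)
        · exact (ContinuousLinearMap.comp_memLp' _ ((hmemF n i).sub (hX i))).aestronglyMeasurable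
        · refine (eLpNorm_le_nnreal_smul_eLpNorm_of_ae_le_mul
            (c := ‖L ∘L .single ℝ (fun _ : I => E) i‖₊) (Eventually.of_forall fun ω => ?_) 2).trans
            le_rfl
          exact ContinuousLinearMap.le_opNNNorm _ _

/-- Two centered real Gaussian processes with a countable index set and with the same
covariance function have the same law. -/
theorem identDistrib_of_isGaussianProcess {T : Type*} [Countable T] {X Y : T → Ω → ℝ}
    (hX : IsGaussianProcess X P) (hY : IsGaussianProcess Y P) (hX0 : ∀ t, ∫ ω, X t ω ∂P = 0)
    (hY0 : ∀ t, ∫ ω, Y t ω ∂P = 0)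
    (h : ∀ s t, ∫ ω, X s ω * X t ω ∂P = ∫ ω, Y s ω * Y t ω ∂P) :
    IdentDistrib (fun ω t => X t ω) (fun ω t => Y t ω) P P := by
  have hP : IsProbabilityMeasure P := hX.isProbabilityMeasure
  have mX : AEMeasurable (fun ω t => X t ω) P := aemeasurable_pi_iff.2 hX.aemeasurable
  have mY : AEMeasurable (fun ω t => Y t ω) P := aemeasurable_pi_iff.2 hY.aemeasurable
  -- The law on the product is determined by its finite marginals, and these by characteristic
  -- functions, which for Gaussian laws involve only means and variances of functionals.
  refine ⟨mX, mY, (map_eq_iff_forall_finset_map_restrict_eq mX mY).2 fun I => ?_⟩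
  have gX := (hX.hasGaussianLaw I)
  have gY := (hY.hasGaussianLaw I)
  have := gX.isGaussian_map
  have := gY.isGaussian_map
  refine Measure.ext_of_charFunDual ?_
  funext L
  rw [gX.charFunDual_map_eq L, gY.charFunDual_map_eq L]
  classical
  have hL : ∀ x : I → ℝ, L x = ∑ i, L (Pi.single i 1) * x i := fun x => by
    conv_lhs => rw [← Finset.univ_sum_single x]
    rw [map_sum]
    refine Finset.sum_congr rfl fun i _ => ?_
    rw [mul_comm, ← smul_eq_mul, ← map_smul, ← Pi.single_smul, smul_eq_mul, mul_one]
  have hc : ∀ Z : T → Ω → ℝ, (L ∘ fun ω => I.restrict (Z · ω)) =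
      fun ω => ∑ i : I, L (Pi.single i 1) * Z i ω := fun Z => funext fun ω => hL _
  have key : ∀ Z : T → Ω → ℝ, IsGaussianProcess Z P → (∀ t, ∫ ω, Z t ω ∂P = 0) →
      (∫ ω, (L ∘ fun ω => I.restrict (Z · ω)) ω ∂P = 0 ∧
      Var[L ∘ fun ω => I.restrict (Z · ω); P] =
        ∑ i : I, ∑ k : I, L (Pi.single i 1) * L (Pi.single k 1) * ∫ ω, Z i ω * Z k ω ∂P) := by
    intro Z hZ hZ0
    have hmem : ∀ t, MemLp (Z t) 2 P := fun t => (hZ.hasGaussianLaw_eval t).memLp_two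
    have e0 : ∫ ω, (L ∘ fun ω => I.restrict (Z · ω)) ω ∂P = 0 := by
      rw [hc, integral_finsetSum _ fun i _ => ?_]
      · refine Finset.sum_eq_zero fun i _ => ?_
        rw [integral_const_mul]
        simp [hZ0]
      · exact ((hmem i).integrable (by norm_num)).const_mul _
    refine ⟨e0, ?_⟩
    rw [variance_eq_sub ((hZ.hasGaussianLaw I).map L).memLp_two, e0]
    have e1 : (L ∘ fun ω => I.restrict (Z · ω)) ^ 2 = fun ω => ∑ i : I, ∑ k : I,
        L (Pi.single i 1) * L (Pi.single k 1) * (Z i ω * Z k ω) := by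
      funext ω
      rw [hc]
      simp only [Pi.pow_apply, pow_two, Finset.sum_mul_sum]
      refine Finset.sum_congr rfl fun i _ => Finset.sum_congr rfl fun k _ => ?_
      ring
    have hint : ∀ i k : I, Integrable (fun ω => L (Pi.single i 1) * L (Pi.single k 1) *
        (Z i ω * Z k ω)) P := fun i k => ((hmem i).integrable_mul (hmem k)).const_mul _
    rw [e1, integral_finsetSum _ fun i _ => integrable_finsetSum _ fun k _ => hint i k]
    simp only [integral_finsetSum _ fun k _ => hint _ k, integral_const_mul]
    simp
  rw [(key X hX hX0).1, (key Y hY hY0).1, (key X hX hX0).2, (key Y hY hY0).2]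
  simp only [h]

end Gaussian

noncomputable section

/-! ### Integration with respect to a complex measure with a density -/

section Density

variable {ν : ℕ} {μ : Measure (Torus ν)} {g : Torus ν → ℂ}

theorem integral_withDensity_enorm (hg : Measurable g) (f : Torus ν → ℂ) :
    ∫ x, f x ∂(μ.withDensity fun x => ‖g x‖ₑ) = ∫ x, (‖g x‖ : ℂ) * f x ∂μ := by
  rw [integral_withDensity_eq_integral_toReal_smul hg.enorm (Eventually.of_forall fun x => by simp)]
  simp

theorem integrable_withDensity_enorm_iff (hg : Measurable g) (f : Torus ν → ℂ) :
    Integrable f (μ.withDensity fun x => ‖g x‖ₑ) ↔ Integrable (fun x => (‖g x‖ : ℂ) * f x) μ := by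
  rw [integrable_withDensity_iff_integrable_smul' hg.enorm (Eventually.of_forall fun x => by simp)]
  simp

theorem isFiniteMeasure_withDensity_enorm (hi : Integrable g μ) :
    IsFiniteMeasure (μ.withDensity fun x => ‖g x‖ₑ) :=
  isFiniteMeasure_withDensity hi.hasFiniteIntegral.ne

/-- The variation of `gμ` is `|g|μ`, and `g = s|g|` with a phase `s`. Both sides are continuous on
L¹(|g|μ), so indicators suffice. -/
theorem cintegral_withDensityᵥ (hg : Measurable g) (hi : Integrable g μ) {f : Torus ν → ℂ}
    (hf : Integrable f (μ.withDensity fun x => ‖g x‖ₑ)) :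
    cintegral (μ.withDensityᵥ g) f = ∫ x, f x * g x ∂μ := by
  have hvar := Measure.variation_withDensityᵥ hi
  have hfin := isFiniteMeasure_withDensity_enorm hi
  -- Where `g = 0` the quotient is 0 by convention, which keeps both `‖s‖ ≤ 1` and `|g| s = g`.
  set s : Torus ν → ℂ := fun x => g x / ‖g x‖ with hs
  have hsm : Measurable s := by fun_prop
  have hs1 : ∀ x, ‖s x‖ ≤ 1 := fun x => by
    simp only [hs, norm_div, Complex.norm_real, norm_norm]
    exact div_self_le_one _
  have hgs : ∀ x, (‖g x‖ : ℂ) * s x = g x := fun x => by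
    by_cases h : g x = 0
    · simp [h]
    · have : (‖g x‖ : ℂ) ≠ 0 := by simpa using h
      simp only [hs]
      field_simp
  have hmul : ∀ f : Torus ν → ℂ, Integrable f (μ.withDensity fun x => ‖g x‖ₑ) →
      Integrable (fun x => s x * f x) (μ.withDensity fun x => ‖g x‖ₑ) := fun f hf =>
    hf.bdd_mul hsm.aestronglyMeasurable (Eventually.of_forall hs1)
  suffices H : cintegral (μ.withDensityᵥ g) f =
      ∫ x, s x * f x ∂(μ.withDensity fun x => ‖g x‖ₑ) by
    rw [H, integral_withDensity_enorm hg]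
    refine integral_congr_ae (Eventually.of_forall fun x => ?_)
    simp only
    rw [← mul_assoc, hgs, mul_comm]
  refine Integrable.induction (P := fun f => cintegral (μ.withDensityᵥ g) f =
      ∫ x, s x * f x ∂(μ.withDensity fun x => ‖g x‖ₑ)) ?_ ?_ ?_ ?_ hf
  · intro c A hA _
    have : IsFiniteMeasure ((μ.withDensityᵥ g).variation.restrict A) := by
      rw [hvar]
      infer_instance
    rw [cintegral, VectorMeasure.integral_indicator_const c hA, withDensityᵥ_apply hi hA,
      integral_withDensity_enorm hg]
    have e : (fun x => (‖g x‖ : ℂ) * (s x * A.indicator (fun _ => c) x)) =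
        A.indicator fun x => c * g x := by
      funext x
      by_cases hx : x ∈ A
      · simp only [hx, Set.indicator_of_mem]
        rw [← mul_assoc, hgs, mul_comm]
      · simp [hx]
    rw [e, integral_indicator hA, integral_const_mul]
    simp
  · intro u v _ hu hv h1 h2
    rw [cintegral, VectorMeasure.integral_add (by rwa [VectorMeasure.Integrable, hvar])
      (by rwa [VectorMeasure.Integrable, hvar])]
    rw [cintegral] at h1 h2
    rw [h1, h2, ← integral_add (hmul u hu) (hmul v hv)]
    simp [mul_add]
  · refine isClosed_eq ?_ ?_
    · have := VectorMeasure.continuous_integral (μ := μ.withDensityᵥ g)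
        (B := ContinuousLinearMap.mul ℝ ℂ)
      rw [hvar] at this
      exact this
    · refine LipschitzWith.continuous (K := 1) (LipschitzWith.of_dist_le_mul fun u v => ?_)
      rw [dist_eq_norm, ← integral_sub (hmul _ (L1.integrable_coeFn u))
        (hmul _ (L1.integrable_coeFn v)), L1.dist_eq_integral_dist, NNReal.coe_one, one_mul]
      simp only [dist_eq_norm]
      refine (norm_integral_le_integral_norm _).trans (integral_mono_of_nonneg
        (Eventually.of_forall fun x => norm_nonneg _)
        ((L1.integrable_coeFn u).sub (L1.integrable_coeFn v)).norm
        (Eventually.of_forall fun x => ?_))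
      simp only
      rw [← mul_sub, norm_mul]
      exact mul_le_of_le_one_left (norm_nonneg _) (hs1 x)
  · intro u v huv _ h1
    rw [cintegral] at h1 ⊢
    rw [← VectorMeasure.integral_congr_ae (f := u) (by rwa [hvar]), h1]
    refine integral_congr_ae ?_
    filter_upwards [huv] with x hx
    rw [hx]

/-- Multiplication by `√|g|` carries the L² norm of `|g|μ` to that of `μ`. Thus the different spaces
L²(G_{jj}) can be compared inside one L²(μ). -/
theorem eLpNorm_two_withDensity_enorm (hg : Measurable g) (u : Torus ν → ℂ) :
    eLpNorm u 2 (μ.withDensity fun x => ‖g x‖ₑ) =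
      eLpNorm (fun x => (Real.sqrt ‖g x‖ : ℂ) * u x) 2 μ := by
  rw [eLpNorm_eq_lintegral_rpow_enorm_toReal (by simp) (by simp),
    eLpNorm_eq_lintegral_rpow_enorm_toReal (by simp) (by simp),
    lintegral_withDensity_eq_lintegral_mul_non_measurable _ hg.enorm
      (Eventually.of_forall fun x => by simp)]
  congr 2
  funext x
  have h1 : ‖(Real.sqrt ‖g x‖ : ℂ)‖ₑ ^ (2 : ℝ) = ‖g x‖ₑ := by
    rw [← ofReal_norm, ← ofReal_norm, Complex.norm_real, Real.norm_eq_abs,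
      abs_of_nonneg (Real.sqrt_nonneg _), ENNReal.ofReal_rpow_of_nonneg (Real.sqrt_nonneg _)
      (by norm_num), Real.rpow_two, Real.sq_sqrt (norm_nonneg _)]
  simp only [ENNReal.toReal_ofNat, Pi.mul_apply, enorm_mul]
  rw [ENNReal.mul_rpow_of_nonneg _ _ (by norm_num), h1]

theorem memLp_sqrt_mul (hg : Measurable g) {u : Torus ν → ℂ}
    (hu : MemLp u 2 (μ.withDensity fun x => ‖g x‖ₑ)) :
    MemLp (fun x => (Real.sqrt ‖g x‖ : ℂ) * u x) 2 μ := by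
  refine ⟨?_, by rw [← eLpNorm_two_withDensity_enorm hg]; exact hu.2⟩
  -- Nothing is known about `u` where `g = 0`, so measurability is available for `|g| u` only;
  -- dividing by `√|g|`, with inverse 0 at 0, recovers the claim.
  have h1 : AEStronglyMeasurable (fun x => (‖g x‖₊ : ℝ) • u x) μ :=
    (aestronglyMeasurable_withDensity_iff (f := fun x => ‖g x‖₊) hg.nnnorm).1 hu.1
  have h2 : AEStronglyMeasurable (fun x => ((Real.sqrt ‖g x‖)⁻¹ : ℂ)) μ :=
    Measurable.aestronglyMeasurable (by fun_prop)
  refine (h2.mul h1).congr (Eventually.of_forall fun x => ?_)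
  simp only [Pi.mul_apply, coe_nnnorm, Complex.real_smul]
  rw [← mul_assoc]
  congr 1
  by_cases h : g x = 0
  · simp [h]
  · have h3 : (Real.sqrt ‖g x‖ : ℂ) ≠ 0 := by
      simpa [Real.sqrt_eq_zero'] using h
    have h4 : (‖g x‖ : ℂ) = (Real.sqrt ‖g x‖ : ℂ) * (Real.sqrt ‖g x‖ : ℂ) := by
      rw [← Complex.ofReal_mul, Real.mul_self_sqrt (norm_nonneg _)]
    rw [h4]
    field_simp

end Density

/-! ### Densities of a positive semidefinite matrix valued measure -/

/-- A measurable density of the matrix valued measure `G` with respect to `μ`. -/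
structure IsSpectralDensity {ν d : ℕ} (G : MatrixMeasure ν d) (μ : Measure (Torus ν))
    (g : Fin d → Fin d → Torus ν → ℂ) : Prop where
  measurable : ∀ j j', Measurable (g j j')
  integrable : ∀ j j', Integrable (g j j') μ
  eq_withDensityᵥ : ∀ j j', G j j' = μ.withDensityᵥ (g j j')
  posSemidef : ∀ᵐ x ∂μ, (Matrix.of fun j j' => g j j' x).PosSemidef

/-- Each entry is replaced by a measurable version; finitely many entries change only on a common
null set, so positivity persists. -/
theorem IsPosSemidefMeasure.exists_density {ν d : ℕ} {G : MatrixMeasure ν d}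
    (hG : IsPosSemidefMeasure G) : ∃ μ g, IsSpectralDensity G μ g := by
  obtain ⟨μ, -, g, hg, hpos⟩ := hG
  have hm := fun j j' => (hg j j').1.aestronglyMeasurable
  refine ⟨μ, fun j j' => (hm j j').mk _, fun j j' => (hm j j').stronglyMeasurable_mk.measurable,
    fun j j' => (hg j j').1.congr (hm j j').ae_eq_mk, fun j j' => ?_, ?_⟩
  · rw [(hg j j').2]
    exact WithDensityᵥEq.congr_ae (hm j j').ae_eq_mk
  · have : ∀ᵐ x ∂μ, ∀ j j', g x j j' = (hm j j').mk _ x :=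
      ae_all_iff.2 fun j => ae_all_iff.2 fun j' => (hm j j').ae_eq_mk
    filter_upwards [hpos, this] with x h1 h2
    convert h1 using 1
    ext j j'
    simp [h2]

namespace IsSpectralDensity

variable {ν d : ℕ} {G : MatrixMeasure ν d} {μ : Measure (Torus ν)}
  {g : Fin d → Fin d → Torus ν → ℂ}

theorem variation (h : IsSpectralDensity G μ g) (j j' : Fin d) :
    (G j j').variation = μ.withDensity fun x => ‖g j j' x‖ₑ := by
  rw [h.eq_withDensityᵥ, Measure.variation_withDensityᵥ (h.integrable j j')]

theorem diagMeasure_eq (h : IsSpectralDensity G μ g) (j : Fin d) :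
    diagMeasure G j = μ.withDensity fun x => ‖g j j x‖ₑ :=
  h.variation j j

theorem ae_diag_eq_norm (h : IsSpectralDensity G μ g) (j : Fin d) :
    ∀ᵐ x ∂μ, (‖g j j x‖ : ℂ) = g j j x := by
  filter_upwards [h.posSemidef] with x hx
  exact Complex.norm_of_nonneg' (hx.diag_nonneg (i := j))

/-- The principal 2×2 minor is nonnegative and the matrix is Hermitian. For `j = j'` the submatrix
repeats a row, which does no harm. -/
theorem ae_norm_sq_le (h : IsSpectralDensity G μ g) (j j' : Fin d) :
    ∀ᵐ x ∂μ, ‖g j j' x‖ ^ 2 ≤ ‖g j j x‖ * ‖g j' j' x‖ := by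
  filter_upwards [h.posSemidef, h.ae_diag_eq_norm j, h.ae_diag_eq_norm j'] with x hx h1 h2
  have hd := (hx.submatrix ![j, j']).det_nonneg
  have hh : g j' j x = conj (g j j' x) := by
    have := hx.isHermitian.apply j' j
    simpa using this.symm
  rw [Matrix.det_fin_two] at hd
  simp only [Matrix.submatrix_apply, Matrix.of_apply, Matrix.cons_val_zero, Matrix.cons_val_one,
    hh, Complex.mul_conj'] at hd
  rw [← h1, ← h2] at hd
  norm_cast at hd
  linarith

/-- The normalised density `g j j' / √(g j j) √(g j' j')`. -/
def ratio (g : Fin d → Fin d → Torus ν → ℂ) (j j' : Fin d) (x : Torus ν) : ℂ :=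
  g j j' x / ((Real.sqrt ‖g j j x‖ : ℂ) * (Real.sqrt ‖g j' j' x‖ : ℂ))

theorem measurable_ratio (h : IsSpectralDensity G μ g) (j j' : Fin d) :
    Measurable (ratio g j j') := by
  have := h.measurable
  unfold ratio
  fun_prop

theorem ae_norm_le (h : IsSpectralDensity G μ g) (j j' : Fin d) :
    ∀ᵐ x ∂μ, ‖g j j' x‖ ≤ Real.sqrt ‖g j j x‖ * Real.sqrt ‖g j' j' x‖ := by
  filter_upwards [h.ae_norm_sq_le j j'] with x hx
  rw [← Real.sqrt_mul (norm_nonneg _)]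
  exact Real.le_sqrt_of_sq_le hx

theorem ae_norm_ratio_le (h : IsSpectralDensity G μ g) (j j' : Fin d) :
    ∀ᵐ x ∂μ, ‖ratio g j j' x‖ ≤ 1 := by
  filter_upwards [h.ae_norm_le j j'] with x hx
  simp only [ratio, norm_div, norm_mul, Complex.norm_real, Real.norm_eq_abs,
    abs_of_nonneg (Real.sqrt_nonneg _)]
  exact div_le_one_of_le₀ hx (by positivity)

theorem ae_ratio_mul (h : IsSpectralDensity G μ g) (j j' : Fin d) :
    ∀ᵐ x ∂μ, ratio g j j' x * ((Real.sqrt ‖g j j x‖ : ℂ) * (Real.sqrt ‖g j' j' x‖ : ℂ)) =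
      g j j' x := by
  filter_upwards [h.ae_norm_le j j'] with x hx
  by_cases h0 : (Real.sqrt ‖g j j x‖ : ℂ) * (Real.sqrt ‖g j' j' x‖ : ℂ) = 0
  -- Where a diagonal density vanishes, the Cauchy–Schwarz bound forces `g j j'` to vanish too.
  · have : Real.sqrt ‖g j j x‖ * Real.sqrt ‖g j' j' x‖ = 0 := by exact_mod_cast h0
    rw [this] at hx
    rw [h0, norm_le_zero_iff.1 hx, mul_zero]
  · rw [ratio, div_mul_cancel₀ _ h0]

theorem isFiniteMeasure_diagMeasure (h : IsSpectralDensity G μ g) (j : Fin d) :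
    IsFiniteMeasure (diagMeasure G j) := by
  rw [h.diagMeasure_eq]
  exact isFiniteMeasure_withDensity_enorm (h.integrable j j)

theorem memLp_sqrt (h : IsSpectralDensity G μ g) {j : Fin d} {u : Torus ν → ℂ}
    (hu : MemLp u 2 (diagMeasure G j)) :
    MemLp (fun x => (Real.sqrt ‖g j j x‖ : ℂ) * u x) 2 μ := by
  rw [h.diagMeasure_eq] at hu
  exact memLp_sqrt_mul (h.measurable j j) hu

theorem memLp_ratio_sqrt (h : IsSpectralDensity G μ g) {j : Fin d} (j' : Fin d)
    {u : Torus ν → ℂ} (hu : MemLp u 2 (diagMeasure G j)) :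
    MemLp (fun x => ratio g j j' x * ((Real.sqrt ‖g j j x‖ : ℂ) * u x)) 2 μ :=
  (h.memLp_sqrt hu).of_le ((h.measurable_ratio j j').aestronglyMeasurable.mul
    (h.memLp_sqrt hu).1) ((h.ae_norm_ratio_le j j').mono fun x hx => by
      rw [norm_mul]
      exact mul_le_of_le_one_left (norm_nonneg _) hx)

/-- This writes the integrand as a product of two L²(μ) functions; the factor `ratio`, bounded by 1,
is put with `u`. -/
theorem ae_mul_conj_mul (h : IsSpectralDensity G μ g) (j j' : Fin d) (u v : Torus ν → ℂ) :
    (fun x => (ratio g j j' x * ((Real.sqrt ‖g j j x‖ : ℂ) * u x)) *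
      conj ((Real.sqrt ‖g j' j' x‖ : ℂ) * v x)) =ᵐ[μ] fun x => u x * conj (v x) * g j j' x := by
  filter_upwards [h.ae_ratio_mul j j'] with x hx
  rw [← hx, map_mul, Complex.conj_ofReal]
  ring

theorem integrable_mul_conj_mul (h : IsSpectralDensity G μ g) {j j' : Fin d}
    {u v : Torus ν → ℂ} (hu : MemLp u 2 (diagMeasure G j)) (hv : MemLp v 2 (diagMeasure G j')) :
    Integrable (fun x => u x * conj (v x) * g j j' x) μ :=
  (integrable_mul_conj (h.memLp_ratio_sqrt j' hu) (h.memLp_sqrt hv)).congr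
    (h.ae_mul_conj_mul j j' u v)

theorem integrable_mul_conj_variation (h : IsSpectralDensity G μ g) {j j' : Fin d}
    {u v : Torus ν → ℂ} (hu : MemLp u 2 (diagMeasure G j)) (hv : MemLp v 2 (diagMeasure G j')) :
    (G j j').Integrable fun x => u x * conj (v x) := by
  rw [VectorMeasure.Integrable, h.variation,
    integrable_withDensity_enorm_iff (h.measurable j j')]
  -- The phase `|g|/g` turns integrability against `g` into integrability against `|g|`.
  have hm : Measurable fun x => (‖g j j' x‖ : ℂ) / g j j' x := by
    have := h.measurable
    fun_prop
  refine ((h.integrable_mul_conj_mul hu hv).bdd_mul hm.aestronglyMeasurable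
    (Eventually.of_forall fun x => ?_) (c := 1)).congr (Eventually.of_forall fun x => ?_)
  · rw [norm_div, Complex.norm_real, norm_norm]
    exact div_self_le_one _
  · by_cases h0 : g j j' x = 0
    · simp [h0]
    · field_simp

theorem cintegral_eq (h : IsSpectralDensity G μ g) {j j' : Fin d}
    {u v : Torus ν → ℂ} (hu : MemLp u 2 (diagMeasure G j)) (hv : MemLp v 2 (diagMeasure G j')) :
    cintegral (G j j') (fun x => u x * conj (v x)) = ∫ x, u x * conj (v x) * g j j' x ∂μ := by
  have hi := h.integrable_mul_conj_variation hu hv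
  rw [VectorMeasure.Integrable, h.variation] at hi
  rw [h.eq_withDensityᵥ, cintegral_withDensityᵥ (h.measurable j j') (h.integrable j j') hi]

end IsSpectralDensity

/-! ### The sesquilinear forms of a positive semidefinite matrix valued measure -/

/-- The form `∫ u v̄ dG_{j,j'}`. -/
def spectralForm {ν d : ℕ} (G : MatrixMeasure ν d) (j j' : Fin d) (u v : Torus ν → ℂ) : ℂ :=
  cintegral (G j j') fun x => u x * conj (v x)

namespace IsPosSemidefMeasure

variable {ν d : ℕ} {G : MatrixMeasure ν d}

theorem isFiniteMeasure_diagMeasure (hG : IsPosSemidefMeasure G) (j : Fin d) :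
    IsFiniteMeasure (diagMeasure G j) := by
  obtain ⟨μ, g, h⟩ := hG.exists_density
  exact h.isFiniteMeasure_diagMeasure j

theorem integrable_mul_conj (hG : IsPosSemidefMeasure G) {j j' : Fin d} {u v : Torus ν → ℂ}
    (hu : MemLp u 2 (diagMeasure G j)) (hv : MemLp v 2 (diagMeasure G j')) :
    (G j j').Integrable fun x => u x * conj (v x) := by
  obtain ⟨μ, g, h⟩ := hG.exists_density
  exact h.integrable_mul_conj_variation hu hv

/-- The form is an inner product in L²(μ) of images of `u` and `v` under contractions from
L²(G_{jj}) and L²(G_{j'j'}), hence jointly continuous. -/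
theorem tendsto_spectralForm (hG : IsPosSemidefMeasure G) {j j' : Fin d} {u v : Torus ν → ℂ}
    {U V : ℕ → Torus ν → ℂ}
    (hu : MemLp u 2 (diagMeasure G j)) (hv : MemLp v 2 (diagMeasure G j'))
    (hU : ∀ n, MemLp (U n) 2 (diagMeasure G j)) (hV : ∀ n, MemLp (V n) 2 (diagMeasure G j'))
    (hUu : Tendsto (fun n => eLpNorm (fun x => U n x - u x) 2 (diagMeasure G j)) atTop (𝓝 0))
    (hVv : Tendsto (fun n => eLpNorm (fun x => V n x - v x) 2 (diagMeasure G j')) atTop (𝓝 0)) :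
    Tendsto (fun n => spectralForm G j j' (U n) (V n)) atTop (𝓝 (spectralForm G j j' u v)) := by
  obtain ⟨μ, g, h⟩ := hG.exists_density
  have e : ∀ u v : Torus ν → ℂ, MemLp u 2 (diagMeasure G j) → MemLp v 2 (diagMeasure G j') →
      spectralForm G j j' u v = ∫ x, (IsSpectralDensity.ratio g j j' x *
        ((Real.sqrt ‖g j j x‖ : ℂ) * u x)) * conj ((Real.sqrt ‖g j' j' x‖ : ℂ) * v x) ∂μ :=
    fun u v hu hv => by
      rw [spectralForm, h.cintegral_eq hu hv]
      exact integral_congr_ae (h.ae_mul_conj_mul j j' u v).symm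
  rw [e u v hu hv]
  simp only [fun n => e _ _ (hU n) (hV n)]
  refine tendsto_integral_mul_conj (h.memLp_ratio_sqrt j' hu) (h.memLp_sqrt hv)
    (fun n => h.memLp_ratio_sqrt j' (hU n)) (fun n => h.memLp_sqrt (hV n)) ?_ ?_
  · refine tendsto_of_tendsto_of_tendsto_of_le_of_le tendsto_const_nhds hUu (fun _ => zero_le)
      fun n => ?_
    rw [h.diagMeasure_eq, eLpNorm_two_withDensity_enorm (h.measurable j j)]
    refine eLpNorm_mono_ae ?_
    filter_upwards [h.ae_norm_ratio_le j j'] with x hx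
    rw [← mul_sub, ← mul_sub, norm_mul]
    exact mul_le_of_le_one_left (norm_nonneg _) hx
  · refine tendsto_of_tendsto_of_tendsto_of_le_of_le tendsto_const_nhds hVv (fun _ => zero_le)
      fun n => ?_
    rw [h.diagMeasure_eq, eLpNorm_two_withDensity_enorm (h.measurable j' j')]
    simp only [← mul_sub]
    exact le_rfl

theorem spectralForm_self (hG : IsPosSemidefMeasure G) {j : Fin d} {u v : Torus ν → ℂ}
    (hu : MemLp u 2 (diagMeasure G j)) (hv : MemLp v 2 (diagMeasure G j)) :
    spectralForm G j j u v = ∫ x, u x * conj (v x) ∂(diagMeasure G j) := by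
  obtain ⟨μ, g, h⟩ := hG.exists_density
  rw [spectralForm, h.cintegral_eq hu hv, h.diagMeasure_eq,
    integral_withDensity_enorm (h.measurable j j)]
  refine integral_congr_ae ?_
  filter_upwards [h.ae_diag_eq_norm j] with x hx
  rw [hx, mul_comm]

theorem spectralForm_sum (hG : IsPosSemidefMeasure G) {j j' : Fin d} {ι κ : Type*}
    (s : Finset ι) (t : Finset κ) (a : ι → ℂ) (b : κ → ℂ) {u : ι → Torus ν → ℂ}
    {v : κ → Torus ν → ℂ} (hu : ∀ i, MemLp (u i) 2 (diagMeasure G j))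
    (hv : ∀ k, MemLp (v k) 2 (diagMeasure G j')) :
    spectralForm G j j' (fun x => ∑ i ∈ s, a i * u i x) (fun x => ∑ k ∈ t, b k * v k x) =
      ∑ i ∈ s, ∑ k ∈ t, a i * conj (b k) * spectralForm G j j' (u i) (v k) := by
  obtain ⟨μ, g, h⟩ := hG.exists_density
  rw [spectralForm, h.cintegral_eq (MemLp.finset_sum_mul s a hu) (MemLp.finset_sum_mul t b hv)]
  have e : (fun x => (∑ i ∈ s, a i * u i x) * conj (∑ k ∈ t, b k * v k x) * g j j' x) =
      fun x => ∑ i ∈ s, ∑ k ∈ t, a i * conj (b k) * (u i x * conj (v k x) * g j j' x) := by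
    funext x
    rw [map_sum, Finset.sum_mul_sum, Finset.sum_mul]
    refine Finset.sum_congr rfl fun i _ => ?_
    rw [Finset.sum_mul]
    refine Finset.sum_congr rfl fun k _ => ?_
    rw [map_mul]
    ring
  have hi : ∀ i k, Integrable (fun x => a i * conj (b k) * (u i x * conj (v k x) * g j j' x)) μ :=
    fun i k => (h.integrable_mul_conj_mul (hu i) (hv k)).const_mul _
  rw [e, integral_finsetSum _ fun i _ => integrable_finsetSum _ fun k _ => hi i k]
  refine Finset.sum_congr rfl fun i _ => ?_
  rw [integral_finsetSum _ fun k _ => hi i k]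
  refine Finset.sum_congr rfl fun k _ => ?_
  rw [integral_const_mul, spectralForm, h.cintegral_eq (hu i) (hv k)]

theorem memLp_indicator (hG : IsPosSemidefMeasure G) (j : Fin d) {A : Set (Torus ν)}
    (hA : MeasurableSet A) : MemLp (A.indicator fun _ => (1 : ℂ)) 2 (diagMeasure G j) := by
  have := hG.isFiniteMeasure_diagMeasure j
  exact memLp_indicator_const 2 hA 1 (Or.inr (measure_ne_top _ _))

theorem spectralForm_indicator (hG : IsPosSemidefMeasure G) {j j' : Fin d} {A B : Set (Torus ν)}
    (hA : MeasurableSet A) (hB : MeasurableSet B) :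
    spectralForm G j j' (A.indicator fun _ => 1) (B.indicator fun _ => 1) = G j j' (A ∩ B) := by
  obtain ⟨μ, g, h⟩ := hG.exists_density
  rw [spectralForm, h.cintegral_eq (hG.memLp_indicator j hA) (hG.memLp_indicator j' hB),
    h.eq_withDensityᵥ, withDensityᵥ_apply (h.integrable j j') (hA.inter hB),
    ← integral_indicator (hA.inter hB)]
  congr 1
  funext x
  by_cases h1 : x ∈ A <;> by_cases h2 : x ∈ B <;> simp [h1, h2]

end IsPosSemidefMeasure

/-! ### Reflection -/

/-- The function `x ↦ conj (u (-x))`. -/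
def reflectConj {ν : ℕ} (u : Torus ν → ℂ) (x : Torus ν) : ℂ := conj (u (-x))

namespace IsMatrixSpectralMeasure

variable {ν d : ℕ} {G : MatrixMeasure ν d}

/-- Evenness conjugates `G j j` under reflection, and the diagonal entries are real. -/
theorem measurePreserving_neg (hG : IsMatrixSpectralMeasure G) (j : Fin d) :
    MeasurePreserving (fun x : Torus ν => -x) (diagMeasure G j) (diagMeasure G j) := by
  have := hG.posSemidef.isFiniteMeasure_diagMeasure j
  refine ⟨measurable_neg, Measure.ext fun A hA => ?_⟩
  rw [Measure.map_apply measurable_neg hA]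
  have h1 := diagMeasure_real hG.posSemidef j hA
  have h2 := diagMeasure_real hG.posSemidef j hA.neg
  rw [hG.even j j A hA, ← h1, Complex.conj_ofReal] at h2
  have h3 : (diagMeasure G j).real (-A) = (diagMeasure G j).real A := by exact_mod_cast h2
  exact (measureReal_eq_measureReal_iff).1 h3

theorem memLp_reflectConj (hG : IsMatrixSpectralMeasure G) {j : Fin d} {u : Torus ν → ℂ}
    (hu : MemLp u 2 (diagMeasure G j)) : MemLp (reflectConj u) 2 (diagMeasure G j) :=
  (hu.comp_measurePreserving (hG.measurePreserving_neg j)).star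

theorem eLpNorm_reflectConj (hG : IsMatrixSpectralMeasure G) {j : Fin d} {u : Torus ν → ℂ}
    (hu : MemLp u 2 (diagMeasure G j)) :
    eLpNorm (reflectConj u) 2 (diagMeasure G j) = eLpNorm u 2 (diagMeasure G j) := by
  rw [← eLpNorm_comp_measurePreserving hu.1 (hG.measurePreserving_neg j)]
  refine eLpNorm_congr_norm_ae (Eventually.of_forall fun x => ?_)
  simp [reflectConj]

end IsMatrixSpectralMeasure

end

noncomputable section

/-! ### Extension by continuity with respect to a matrix valued spectral measure -/

/-- The functions `φ i` are dense in all the spaces `L²(G_{j,j})`, and the random variables `Φ j i`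
have the covariances `∫ φ i conj (φ k) dG_{j,j'}`. -/
structure IsSpectralIsometry {ν d : ℕ} {ι Ω : Type*} [MeasurableSpace Ω] (P : Measure Ω)
    (G : MatrixMeasure ν d) (φ : ι → Torus ν → ℂ) (Φ : Fin d → ι → Ω → ℂ) : Prop where
  posSemidef : IsPosSemidefMeasure G
  memLp_source : ∀ j i, MemLp (φ i) 2 (diagMeasure G j)
  memLp_target : ∀ j i, MemLp (Φ j i) 2 P
  gram : ∀ j j' i k, ∫ ω, Φ j i ω * conj (Φ j' k ω) ∂P = spectralForm G j j' (φ i) (φ k)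
  dense : ∀ j u, MemLp u 2 (diagMeasure G j) → ∀ ε : ℝ≥0∞, ε ≠ 0 →
    ∃ i, eLpNorm (fun x => φ i x - u x) 2 (diagMeasure G j) < ε

namespace IsSpectralIsometry

variable {ν d : ℕ} {ι Ω : Type*} [MeasurableSpace Ω] {P : Measure Ω} {G : MatrixMeasure ν d}
  {φ : ι → Torus ν → ℂ} {Φ : Fin d → ι → Ω → ℂ}

theorem isDenseIsometry (h : IsSpectralIsometry P G φ Φ) (j : Fin d) :
    IsDenseIsometry (diagMeasure G j) P φ (Φ j) where
  memLp_source := h.memLp_source j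
  memLp_target := h.memLp_target j
  gram i k := (h.gram j j i k).trans
    (h.posSemidef.spectralForm_self (h.memLp_source j i) (h.memLp_source j k))
  dense := h.dense j

/-- The Gram identity passes to the limit along separate approximations of `u` and `v`: the left
side is an L²(P) inner product, the right side a continuous form. -/
theorem integral_l2Extension_mul_conj (h : IsSpectralIsometry P G φ Φ) {j j' : Fin d}
    {u v : Torus ν → ℂ} (hu : MemLp u 2 (diagMeasure G j)) (hv : MemLp v 2 (diagMeasure G j')) :
    ∫ ω, l2Extension (diagMeasure G j) P φ (Φ j) u ω *
      conj (l2Extension (diagMeasure G j') P φ (Φ j') v ω) ∂P = spectralForm G j j' u v := by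
  obtain ⟨hm, i, hi, hi'⟩ := (h.isDenseIsometry j).isL2Extension_l2Extension hu
  obtain ⟨hm', k, hk, hk'⟩ := (h.isDenseIsometry j').isL2Extension_l2Extension hv
  have h1 := tendsto_integral_mul_conj hm hm' (fun n => h.memLp_target j (i n))
    (fun n => h.memLp_target j' (k n)) hi' hk'
  have h2 := h.posSemidef.tendsto_spectralForm hu hv (fun n => h.memLp_source j (i n))
    (fun n => h.memLp_source j' (k n)) hi hk
  simp only [h.gram] at h1
  exact tendsto_nhds_unique h1 h2

theorem isL2Isometry (h : IsSpectralIsometry P G φ Φ) (j : Fin d) :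
    IsL2Isometry (diagMeasure G j) P (l2Extension (diagMeasure G j) P φ (Φ j)) where
  memLp _ hu := (h.isDenseIsometry j).memLp_l2Extension hu
  gram _ _ hu hv := (h.integral_l2Extension_mul_conj hu hv).trans
    (h.posSemidef.spectralForm_self hu hv)

theorem integral_l2Extension [IsProbabilityMeasure P] (h : IsSpectralIsometry P G φ Φ)
    (h0 : ∀ j i, ∫ ω, Φ j i ω ∂P = 0) {j : Fin d} {u : Torus ν → ℂ}
    (hu : MemLp u 2 (diagMeasure G j)) :
    ∫ ω, l2Extension (diagMeasure G j) P φ (Φ j) u ω ∂P = 0 := by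
  obtain ⟨hm, i, -, hi'⟩ := (h.isDenseIsometry j).isL2Extension_l2Extension hu
  have h1 := tendsto_integral_of_tendsto_eLpNorm_two hm (fun n => h.memLp_target j (i n)) hi'
  simp only [h0] at h1
  exact (tendsto_nhds_unique tendsto_const_nhds h1).symm

/-- `σ` realises the reflection on the dense family. If `φ (i n)` approximates `u`, then `φ (σ (i
n))` approximates its reflection, because `G j j` is reflection invariant. -/
theorem l2Extension_reflectConj (h : IsSpectralIsometry P G φ Φ)
    (hG : IsMatrixSpectralMeasure G) {σ : ι → ι} (hφ : ∀ i, φ (σ i) = reflectConj (φ i))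
    (hΦ : ∀ j i, Φ j (σ i) =ᵐ[P] fun ω => conj (Φ j i ω)) {j : Fin d} {u : Torus ν → ℂ}
    (hu : MemLp u 2 (diagMeasure G j)) :
    l2Extension (diagMeasure G j) P φ (Φ j) (reflectConj u) =ᵐ[P]
      fun ω => conj (l2Extension (diagMeasure G j) P φ (Φ j) u ω) := by
  obtain ⟨hm, i, hi, hi'⟩ := (h.isDenseIsometry j).isL2Extension_l2Extension hu
  refine (h.isDenseIsometry j).l2Extension_ae_eq (hG.memLp_reflectConj hu)
    ⟨hm.star, fun n => σ (i n), ?_, ?_⟩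
  · refine hi.congr fun n => ?_
    refine (hG.eLpNorm_reflectConj ((h.memLp_source j (i n)).sub hu)).symm.trans ?_
    simp only [hφ]
    congr 1
    funext x
    simp [reflectConj]
  · refine hi'.congr fun n => ?_
    refine eLpNorm_congr_norm_ae ((hΦ j (i n)).mono fun ω hω => ?_)
    rw [hω, ← map_sub, RCLike.norm_conj]

theorem isGaussianProcess_l2Extension (h : IsSpectralIsometry P G φ Φ)
    (hg : IsGaussianProcess (fun (t : Fin d × ι) ω => Φ t.1 t.2 ω) P) {T : Type*}
    (j : T → Fin d) {u : T → Torus ν → ℂ} (hu : ∀ t, MemLp (u t) 2 (diagMeasure G (j t))) :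
    IsGaussianProcess
      (fun t ω => l2Extension (diagMeasure G (j t)) P φ (Φ (j t)) (u t) ω) P := by
  choose hm i _ hi' using fun t => (h.isDenseIsometry (j t)).isL2Extension_l2Extension (hu t)
  exact isGaussianProcess_of_tendsto_eLpNorm (F := fun n t => Φ (j t) (i t n)) hm
    (fun n => hg.comp_right fun t => (j t, i t n)) hi'

end IsSpectralIsometry

/-- A process whose variables are finite sums of linear images of the variables of a Gaussian
process is Gaussian. -/
theorem isGaussianProcess_of_sum {Ω S T κ E F : Type*} [MeasurableSpace Ω] {P : Measure Ω}
    [NormedAddCommGroup E] [NormedSpace ℝ E] [MeasurableSpace E] [BorelSpace E]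
    [SecondCountableTopology E] [NormedAddCommGroup F] [NormedSpace ℝ F] [MeasurableSpace F]
    [BorelSpace F] [SecondCountableTopology F] {X : T → Ω → E} {Y : S → Ω → F}
    (hX : IsGaussianProcess X P) (s : S → Finset κ) (t : S → κ → T) (L : S → κ → E →L[ℝ] F)
    (h : ∀ i ω, Y i ω = ∑ k ∈ s i, L i k (X (t i k) ω)) : IsGaussianProcess Y P := by
  classical
  refine hX.of_isGaussianProcess fun i => ⟨(s i).image (t i), ∑ k : s i,
    (L i k).comp (.proj ⟨t i k, Finset.mem_image_of_mem _ k.2⟩), fun ω => ?_⟩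
  rw [h, ← Finset.sum_coe_sort]
  simp [Finset.restrict_def]

/-! ### Characters -/

variable {ν d : ℕ}

instance fact_two_pi_pos : Fact (0 < 2 * Real.pi) := ⟨Real.two_pi_pos⟩

theorem continuous_torusChar (p : Fin ν → ℤ) : Continuous (torusChar p : Torus ν → ℂ) := by
  unfold torusChar
  fun_prop

theorem torusChar_mul_conj (p q : Fin ν → ℤ) (x : Torus ν) :
    torusChar p x * conj (torusChar q x) = torusChar (p - q) x := by
  simp only [torusChar, map_prod, ← Finset.prod_mul_distrib, Pi.sub_apply, sub_eq_add_neg,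
    fourier_add, fourier_neg]

/-- This invariance is what makes the integrals of the characters real. -/
theorem reflectConj_torusChar (p : Fin ν → ℤ) : reflectConj (torusChar p) = torusChar p := by
  funext x
  simp only [reflectConj, torusChar, map_prod, Pi.neg_apply, ← fourier_neg]
  simp [fourier_apply]

theorem IsPosSemidefMeasure.memLp_torusChar {G : MatrixMeasure ν d} (hG : IsPosSemidefMeasure G)
    (j : Fin d) (p : Fin ν → ℤ) : MemLp (torusChar p) 2 (diagMeasure G j) := by
  have := hG.isFiniteMeasure_diagMeasure j
  obtain ⟨C, hC⟩ := isCompact_univ.exists_bound_of_continuousOn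
    (continuous_torusChar p).continuousOn
  exact MemLp.of_bound (continuous_torusChar p).measurable.aestronglyMeasurable C
    (Eventually.of_forall fun x => hC x (Set.mem_univ x))

theorem spectralForm_torusChar (G : MatrixMeasure ν d) (j j' : Fin d) (p q : Fin ν → ℤ) :
    spectralForm G j j' (torusChar p) (torusChar q) = cintegral (G j j') (torusChar (p - q)) := by
  simp only [spectralForm, torusChar_mul_conj]

/-! ### The random integral -/

namespace IsRandomSpectralMeasure

variable {Ω : Type*} [MeasurableSpace Ω] {P : Measure Ω} {G : MatrixMeasure ν d}
  {Z : Fin d → Set (Torus ν) → Ω → ℂ}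

theorem memLp (hZ : IsRandomSpectralMeasure P G Z) (j : Fin d) {A : Set (Torus ν)}
    (hA : MeasurableSet A) : MemLp (Z j A) 2 P :=
  (hZ.gaussian.hasGaussianLaw_eval (j, ⟨A, hA⟩)).memLp_two

/-- Additivity over the empty family. -/
theorem apply_empty (hZ : IsRandomSpectralMeasure P G Z) (j : Fin d) :
    Z j ∅ =ᵐ[P] fun _ => 0 := by
  have h := hZ.additive j 0 (fun _ => ∅) (fun _ => MeasurableSet.empty)
    fun s => s.elim0
  simpa using h.symm

theorem integral_sum_mul_conj_sum (hZ : IsRandomSpectralMeasure P G Z) (j j' : Fin d)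
    {ι κ : Type*} (s : Finset ι) (t : Finset κ) (a : ι → ℂ) (b : κ → ℂ)
    {A : ι → Set (Torus ν)} {B : κ → Set (Torus ν)} (hA : ∀ i, MeasurableSet (A i))
    (hB : ∀ k, MeasurableSet (B k)) :
    ∫ ω, (∑ i ∈ s, a i * Z j (A i) ω) * conj (∑ k ∈ t, b k * Z j' (B k) ω) ∂P =
      ∑ i ∈ s, ∑ k ∈ t, a i * conj (b k) * G j j' (A i ∩ B k) := by
  have e : (fun ω => (∑ i ∈ s, a i * Z j (A i) ω) * conj (∑ k ∈ t, b k * Z j' (B k) ω)) =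
      fun ω => ∑ i ∈ s, ∑ k ∈ t, a i * conj (b k) * (Z j (A i) ω * conj (Z j' (B k) ω)) := by
    funext ω
    rw [map_sum, Finset.sum_mul_sum]
    refine Finset.sum_congr rfl fun i _ => Finset.sum_congr rfl fun k _ => ?_
    rw [map_mul]
    ring
  have hi : ∀ i k, Integrable
      (fun ω => a i * conj (b k) * (Z j (A i) ω * conj (Z j' (B k) ω))) P :=
    fun i k => (integrable_mul_conj (hZ.memLp j (hA i)) (hZ.memLp j' (hB k))).const_mul _
  rw [e, integral_finsetSum _ fun i _ => integrable_finsetSum _ fun k _ => hi i k]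
  refine Finset.sum_congr rfl fun i _ => ?_
  rw [integral_finsetSum _ fun k _ => hi i k]
  refine Finset.sum_congr rfl fun k _ => ?_
  rw [integral_const_mul, hZ.covariance j j' _ _ (hA i) (hB k)]

end IsRandomSpectralMeasure

theorem simpleFunc_eq_sum_indicator (s : SimpleFunc (Torus ν) ℂ) :
    (fun x => s x) = fun x => ∑ c ∈ s.range, c * (s ⁻¹' {c}).indicator (fun _ => 1) x := by
  funext x
  rw [Finset.sum_eq_single (s x)]
  · simp
  · intro c _ hc
    simp [Set.indicator, Ne.symm hc]
  · intro h
    exact absurd (s.mem_range_self x) h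

/-- The simple function `x ↦ conj (s (-x))`. -/
def reflectConjSimple (s : SimpleFunc (Torus ν) ℂ) : SimpleFunc (Torus ν) ℂ :=
  (s.comp (fun x => -x) measurable_neg).map conj

/-- The reflected function takes the value `conj c` on `-{s = c}`. Conjugation is injective, so the
sum reindexes and the Hermitian property of `Z` applies termwise. -/
theorem elementaryIntegral_reflectConjSimple {Ω : Type*} [MeasurableSpace Ω] {P : Measure Ω}
    {G : MatrixMeasure ν d} {Z : Fin d → Set (Torus ν) → Ω → ℂ}
    (hZ : IsRandomSpectralMeasure P G Z) (j : Fin d) (s : SimpleFunc (Torus ν) ℂ) :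
    elementaryIntegral Z j (reflectConjSimple s) =ᵐ[P]
      fun ω => conj (elementaryIntegral Z j s ω) := by
  have hr : (reflectConjSimple s).range = s.range.image conj := by
    ext c
    simp only [SimpleFunc.mem_range, Finset.mem_image, Set.mem_range, reflectConjSimple,
      SimpleFunc.map_apply, SimpleFunc.coe_comp, Function.comp_apply, exists_exists_eq_and]
    exact ⟨fun ⟨x, hx⟩ => ⟨-x, hx⟩, fun ⟨x, hx⟩ => ⟨-x, by simpa using hx⟩⟩
  have hp : ∀ c, reflectConjSimple s ⁻¹' {conj c} = -(s ⁻¹' {c}) := fun c => by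
    ext x
    exact (starRingEnd ℂ).injective.eq_iff
  have h := fun c => hZ.hermitian j _ (s.measurableSet_fiber c)
  have h' : ∀ᵐ ω ∂P, ∀ c ∈ s.range, Z j (s ⁻¹' {c}) ω = conj (Z j (-(s ⁻¹' {c})) ω) :=
    (Finset.eventually_all s.range).2 fun c _ => h c
  filter_upwards [h'] with ω hω
  simp only [elementaryIntegral, hr]
  rw [Finset.sum_image fun a _ b _ hab => (starRingEnd ℂ).injective hab, map_sum]
  refine Finset.sum_congr rfl fun c hc => ?_
  rw [map_mul, hω c hc, Complex.conj_conj, hp]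

/-! ### Properties of the random integral and the field it generates. -/

namespace IsRandomSpectralMeasure

variable {Ω : Type*} [MeasurableSpace Ω] {P : Measure Ω} {G : MatrixMeasure ν d}
  {Z : Fin d → Set (Torus ν) → Ω → ℂ}

/-- The covariance of `Z` is the Gram identity for indicators; sesquilinearity extends it to
elementary functions, which are dense in each L²(G_{jj}). -/
theorem isSpectralIsometry (hZ : IsRandomSpectralMeasure P G Z) (hG : IsPosSemidefMeasure G) :
    IsSpectralIsometry P G (fun (s : SimpleFunc (Torus ν) ℂ) x => s x)
      (elementaryIntegral Z) where
  posSemidef := hG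
  memLp_source j s := by
    have := hG.isFiniteMeasure_diagMeasure j
    exact s.memLp_of_isFiniteMeasure 2 _
  memLp_target j s :=
    memLp_finsetSum _ fun c _ => (hZ.memLp j (s.measurableSet_fiber c)).const_mul c
  gram j j' s t := by
    rw [simpleFunc_eq_sum_indicator s, simpleFunc_eq_sum_indicator t,
      hG.spectralForm_sum s.range t.range (fun c => c) (fun c => c)
        (fun c => hG.memLp_indicator j (s.measurableSet_fiber c))
        (fun c => hG.memLp_indicator j' (t.measurableSet_fiber c))]
    simp only [hG.spectralForm_indicator (s.measurableSet_fiber _) (t.measurableSet_fiber _)]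
    exact hZ.integral_sum_mul_conj_sum j j' s.range t.range (fun c => c) (fun c => c)
      (fun c => s.measurableSet_fiber c) (fun c => t.measurableSet_fiber c)
  dense j u hu ε hε := by
    obtain ⟨s, hs, -⟩ := hu.exists_simpleFunc_eLpNorm_sub_lt (by simp) hε
    refine ⟨s, ?_⟩
    rw [eLpNorm_sub_comm] at hs
    exact hs

theorem integral_elementaryIntegral (hZ : IsRandomSpectralMeasure P G Z)
    [IsProbabilityMeasure P] (j : Fin d) (s : SimpleFunc (Torus ν) ℂ) :
    ∫ ω, elementaryIntegral Z j s ω ∂P = 0 := by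
  simp only [elementaryIntegral]
  rw [integral_finsetSum _ fun c _ =>
    ((hZ.memLp j (s.measurableSet_fiber c)).integrable (by norm_num)).const_mul c]
  refine Finset.sum_eq_zero fun c _ => ?_
  rw [integral_const_mul, hZ.mean_zero j _ (s.measurableSet_fiber c), mul_zero]

theorem isGaussianProcess_elementaryIntegral (hZ : IsRandomSpectralMeasure P G Z) :
    IsGaussianProcess
      (fun (t : Fin d × SimpleFunc (Torus ν) ℂ) ω => elementaryIntegral Z t.1 t.2 ω) P :=
  isGaussianProcess_of_sum hZ.gaussian (fun t => t.2.range)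
    (fun t c => (t.1, ⟨t.2 ⁻¹' {c}, t.2.measurableSet_fiber c⟩))
    (fun _ c => ContinuousLinearMap.mul ℝ ℂ c) fun _ _ => rfl

theorem randomIntegral_indicator (hZ : IsRandomSpectralMeasure P G Z)
    (hG : IsPosSemidefMeasure G) (j : Fin d) {A : Set (Torus ν)} (hA : MeasurableSet A) :
    randomIntegral P G Z j (A.indicator fun _ => 1) =ᵐ[P] Z j A := by
  set s : SimpleFunc (Torus ν) ℂ :=
    SimpleFunc.piecewise A hA (SimpleFunc.const _ 1) (SimpleFunc.const _ 0) with hs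
  have h1 : (fun x => s x) = A.indicator fun _ => 1 := by
    funext x
    by_cases hx : x ∈ A <;> simp [hs, hx]
  have h2 := ((hZ.isSpectralIsometry hG).isDenseIsometry j).l2Extension_apply s
  rw [h1] at h2
  refine EventuallyEq.trans h2 ?_
  have hr : ∀ c ∈ s.range, c ≠ 1 → ∀ ω, c * Z j (s ⁻¹' {c}) ω = 0 := by
    intro c hc hc1 ω
    obtain ⟨x, hx⟩ := SimpleFunc.mem_range.1 hc
    have : s x = A.indicator (fun _ => 1) x := congrFun h1 x
    by_cases hxA : x ∈ A
    · rw [hx, Set.indicator_of_mem hxA] at this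
      exact absurd this hc1
    · rw [hx, Set.indicator_of_notMem hxA] at this
      rw [this, zero_mul]
  have hp : s ⁻¹' {1} = A := by
    ext x
    have : s x = A.indicator (fun _ => 1) x := congrFun h1 x
    by_cases hxA : x ∈ A <;> simp [this, hxA]
  by_cases h0 : (1 : ℂ) ∈ s.range
  · refine Eventually.of_forall fun ω => ?_
    rw [elementaryIntegral, Finset.sum_eq_single 1 (fun c hc hc1 => hr c hc hc1 ω)
      fun h => absurd h0 h, hp, one_mul]
  -- The value 1 is missed only when `A` is empty; then the sum is 0 and `Z j ∅ = 0` is needed.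
  · have hA0 : A = ∅ := by
      rw [← hp]
      refine Set.eq_empty_of_forall_notMem fun x hx => h0 ?_
      rw [← show s x = 1 from hx]
      exact s.mem_range_self x
    filter_upwards [hZ.apply_empty j] with ω hω
    rw [elementaryIntegral, Finset.sum_eq_zero fun c hc =>
      hr c hc (fun h => h0 (h ▸ hc)) ω, hA0, hω]

theorem randomIntegral_elementary (hZ : IsRandomSpectralMeasure P G Z)
    (hG : IsPosSemidefMeasure G) (j : Fin d) (n : ℕ) (c : Fin n → ℂ)
    (A : Fin n → Set (Torus ν)) (hA : ∀ s, MeasurableSet (A s)) :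
    randomIntegral P G Z j (fun x => ∑ s, (A s).indicator (fun _ => c s) x) =ᵐ[P]
      fun ω => ∑ s, c s * Z j (A s) ω := by
  have h1 : (fun x => ∑ s, (A s).indicator (fun _ => c s) x) =
      fun x => ∑ s, c s * (A s).indicator (fun _ => (1 : ℂ)) x := by
    funext x
    refine Finset.sum_congr rfl fun s _ => ?_
    by_cases hx : x ∈ A s <;> simp [hx]
  rw [h1]
  refine (((hZ.isSpectralIsometry hG).isL2Isometry j).map_sum Finset.univ c
    fun s => hG.memLp_indicator j (hA s)).trans ?_
  have h2 : ∀ᵐ ω ∂P, ∀ s, randomIntegral P G Z j ((A s).indicator fun _ => 1) ω = Z j (A s) ω :=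
    ae_all_iff.2 fun s => hZ.randomIntegral_indicator hG j (hA s)
  filter_upwards [h2] with ω hω
  exact Finset.sum_congr rfl fun s _ => by rw [← hω s]; rfl

theorem randomIntegral_reflectConj (hZ : IsRandomSpectralMeasure P G Z)
    (hG : IsMatrixSpectralMeasure G) {j : Fin d} {u : Torus ν → ℂ}
    (hu : MemLp u 2 (diagMeasure G j)) :
    randomIntegral P G Z j (reflectConj u) =ᵐ[P] fun ω => conj (randomIntegral P G Z j u ω) :=
  (hZ.isSpectralIsometry hG.posSemidef).l2Extension_reflectConj hG (σ := reflectConjSimple)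
    (fun _ => rfl) (fun j s => elementaryIntegral_reflectConjSimple hZ j s) hu

theorem randomIntegral_im_eq_zero (hZ : IsRandomSpectralMeasure P G Z)
    (hG : IsMatrixSpectralMeasure G) {j : Fin d} {u : Torus ν → ℂ}
    (hu : MemLp u 2 (diagMeasure G j)) (h : ∀ᵐ x ∂(diagMeasure G j), u (-x) = conj (u x)) :
    ∀ᵐ ω ∂P, (randomIntegral P G Z j u ω).im = 0 := by
  have h1 : reflectConj u =ᵐ[diagMeasure G j] u := h.mono fun x hx => by simp [reflectConj, hx]
  filter_upwards [hZ.randomIntegral_reflectConj hG hu,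
    ((hZ.isSpectralIsometry hG.posSemidef).isL2Isometry j).map_congr
      (hG.memLp_reflectConj hu) h1] with ω h2 h3
  exact Complex.conj_eq_iff_im.1 (h2.symm.trans h3)

theorem randomIntegral_torusChar_im (hZ : IsRandomSpectralMeasure P G Z)
    (hG : IsMatrixSpectralMeasure G) (j : Fin d) (p : Fin ν → ℤ) :
    ∀ᵐ ω ∂P, (randomIntegral P G Z j (torusChar p) ω).im = 0 := by
  refine hZ.randomIntegral_im_eq_zero hG (hG.posSemidef.memLp_torusChar j p)
    (Eventually.of_forall fun x => ?_)
  have := congrFun (reflectConj_torusChar p) x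
  rw [← this, reflectConj, Complex.conj_conj]

theorem integral_re_mul_re (hZ : IsRandomSpectralMeasure P G Z)
    (hG : IsMatrixSpectralMeasure G) (j j' : Fin d) (p q : Fin ν → ℤ) :
    ((∫ ω, (randomIntegral P G Z j (torusChar p) ω).re *
      (randomIntegral P G Z j' (torusChar q) ω).re ∂P : ℝ) : ℂ) =
      cintegral (G j j') (torusChar (p - q)) := by
  rw [← spectralForm_torusChar, ← (hZ.isSpectralIsometry hG.posSemidef).integral_l2Extension_mul_conj
    (hG.posSemidef.memLp_torusChar j p) (hG.posSemidef.memLp_torusChar j' q),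
    ← integral_complex_ofReal]
  refine integral_congr_ae ?_
  filter_upwards [hZ.randomIntegral_torusChar_im hG j p,
    hZ.randomIntegral_torusChar_im hG j' q] with ω h1 h2
  have e : ∀ z : ℂ, z.im = 0 → (z.re : ℂ) = z := fun z hz => Complex.ext rfl (by simp [hz])
  push_cast
  rw [e _ h1, e _ h2]
  change _ = randomIntegral P G Z j (torusChar p) ω *
    conj (randomIntegral P G Z j' (torusChar q) ω)
  rw [Complex.conj_eq_iff_im.2 h2]

theorem isStationaryGaussianField [IsProbabilityMeasure P] (hZ : IsRandomSpectralMeasure P G Z)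
    (hG : IsMatrixSpectralMeasure G) :
    IsStationaryGaussianField P
      (fun j p ω => (randomIntegral P G Z j (torusChar p) ω).re) := by
  have hI := hZ.isSpectralIsometry hG.posSemidef
  have hg : IsGaussianProcess (fun (t : Fin d × (Fin ν → ℤ)) ω =>
      (randomIntegral P G Z t.1 (torusChar t.2) ω).re) P :=
    (hI.isGaussianProcess_l2Extension hZ.isGaussianProcess_elementaryIntegral
      (fun t : Fin d × (Fin ν → ℤ) => t.1) fun t =>
        hG.posSemidef.memLp_torusChar t.1 t.2).comp_left fun _ => Complex.reCLM
  have h0 : ∀ j p, ∫ ω, (randomIntegral P G Z j (torusChar p) ω).re ∂P = 0 := fun j p => by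
    have h1 := hI.integral_l2Extension hZ.integral_elementaryIntegral
      (hG.posSemidef.memLp_torusChar j p)
    have h2 := (hI.isL2Isometry j).memLp _ (hG.posSemidef.memLp_torusChar j p)
    have h3 := integral_re (𝕜 := ℂ) (h2.integrable (by norm_num))
    rw [h1] at h3
    exact h3
  refine ⟨hg, h0, fun m => ?_⟩
  -- Centered Gaussian laws on a countable index set are determined by covariances, and `(p + m) -
  -- (q + m) = p - q`.
  refine identDistrib_of_isGaussianProcess
    (X := fun (t : Fin d × (Fin ν → ℤ)) ω =>
      (randomIntegral P G Z t.1 (torusChar (t.2 + m)) ω).re)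
    (hg.comp_right fun t : Fin d × (Fin ν → ℤ) => (t.1, t.2 + m)) hg (fun _ => h0 _ _)
    (fun _ => h0 _ _) fun s t => ?_
  have := (hZ.integral_re_mul_re hG s.1 t.1 (s.2 + m) (t.2 + m)).trans
    ((by rw [add_sub_add_right_eq_sub]) : _ = cintegral (G s.1 t.1) (torusChar (s.2 - t.2)))
  rw [← hZ.integral_re_mul_re hG] at this
  exact_mod_cast this

end IsRandomSpectralMeasure

end

noncomputable section

/-! ### Density of trigonometric polynomials -/

section TrigPoly

variable {ν d : ℕ}

/-- The character `torusChar p` as a continuous map. -/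
def torusCharMap (p : Fin ν → ℤ) : C(Torus ν, ℂ) := ⟨torusChar p, continuous_torusChar p⟩

theorem conj_torusChar (p : Fin ν → ℤ) (x : Torus ν) :
    conj (torusChar p x) = torusChar (-p) x := by
  simp only [torusChar, map_prod, ← fourier_neg, Pi.neg_apply]

theorem torusChar_zero (x : Torus ν) : torusChar 0 x = 1 := by
  simp [torusChar]

theorem torusChar_add (p q : Fin ν → ℤ) (x : Torus ν) :
    torusChar (p + q) x = torusChar p x * torusChar q x := by
  simp only [torusChar, ← Finset.prod_mul_distrib, Pi.add_apply, fourier_add]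

theorem torusChar_single (i : Fin ν) (x : Torus ν) :
    torusChar (Pi.single i 1) x = AddCircle.toCircle (x i) := by
  rw [torusChar, Finset.prod_eq_single i]
  · simp
  · intro k _ hk
    simp [Pi.single_eq_of_ne hk]
  · simp

/-- The star algebra of trigonometric polynomials. -/
def trigSubalgebra (ν : ℕ) : StarSubalgebra ℂ C(Torus ν, ℂ) where
  toSubalgebra := Algebra.adjoin ℂ (Set.range torusCharMap)
  star_mem' := by
    change Algebra.adjoin ℂ (Set.range torusCharMap) ≤
      star (Algebra.adjoin ℂ (Set.range torusCharMap))
    refine Algebra.adjoin_le ?_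
    rintro _ ⟨p, rfl⟩
    refine Algebra.subset_adjoin ⟨-p, ?_⟩
    ext x
    exact (conj_torusChar p x).symm

/-- Characters are closed under products and include 1, so the algebra they generate is just their
linear span. -/
theorem trigSubalgebra_coe :
    (trigSubalgebra ν).toSubalgebra.toSubmodule = Submodule.span ℂ (Set.range torusCharMap) := by
  apply Algebra.adjoin_eq_span_of_subset
  refine .trans (fun x => Submonoid.closure_induction (fun _ => id) ⟨0, ?_⟩ ?_)
    Submodule.subset_span
  · ext x
    exact torusChar_zero x
  · rintro _ _ _ _ ⟨p, rfl⟩ ⟨q, rfl⟩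
    refine ⟨p + q, ?_⟩
    ext x
    exact torusChar_add p q x

/-- Points that differ in coordinate `i` are separated by `e^{i x_i}`, which is injective on the
circle. -/
theorem trigSubalgebra_separatesPoints : (trigSubalgebra ν).SeparatesPoints := by
  intro x y hxy
  rw [Ne, funext_iff, not_forall] at hxy
  obtain ⟨i, hi⟩ := hxy
  refine ⟨_, ⟨torusCharMap (Pi.single i 1),
    Algebra.subset_adjoin ⟨Pi.single i 1, rfl⟩, rfl⟩, ?_⟩
  change torusChar _ x ≠ torusChar _ y
  rw [torusChar_single, torusChar_single]
  exact fun h => hi (AddCircle.injective_toCircle Real.two_pi_pos.ne' (Circle.ext h))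

theorem dense_span_torusCharMap :
    Dense (Submodule.span ℂ (Set.range (torusCharMap (ν := ν))) : Set C(Torus ν, ℂ)) := by
  rw [← trigSubalgebra_coe]
  have h := ContinuousMap.starSubalgebra_topologicalClosure_eq_top_of_separatesPoints _
    (trigSubalgebra_separatesPoints (ν := ν))
  intro f
  have : f ∈ (trigSubalgebra ν).topologicalClosure := h ▸ StarSubalgebra.mem_top
  exact this

theorem exists_trigPoly_eLpNorm_sub_lt {m : Measure (Torus ν)} [IsFiniteMeasure m]
    {u : Torus ν → ℂ} (hu : MemLp u 2 m) {ε : ℝ≥0∞} (hε : ε ≠ 0) :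
    ∃ c, eLpNorm (fun x => trigPoly c x - u x) 2 m < ε := by
  -- Continuous functions are dense in L²(m), and trigonometric polynomials are uniformly dense
  -- among them; the inclusion is continuous for finite `m`.
  have hd := (ContinuousMap.toLp_denseRange ℂ m ℂ (p := 2) (by simp)).dense_image
    (ContinuousMap.toLp 2 m ℂ).continuous (dense_span_torusCharMap (ν := ν))
  obtain ⟨_, ⟨f, hf, rfl⟩, hfε⟩ := EMetric.mem_closure_iff.1 (hd (hu.toLp u)) ε
    (pos_iff_ne_zero.2 hε)
  obtain ⟨c, hc⟩ := (Finsupp.mem_span_range_iff_exists_finsupp).1 hf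
  refine ⟨c, ?_⟩
  have hfc : ∀ x, f x = trigPoly c x := fun x => by
    rw [← hc, trigPoly, Finsupp.sum, Finsupp.sum, ContinuousMap.sum_apply]
    rfl
  rw [edist_comm, Lp.edist_def] at hfε
  refine lt_of_eq_of_lt (eLpNorm_congr_ae ?_) hfε
  filter_upwards [hu.coeFn_toLp, ContinuousMap.coeFn_toLp (p := 2) (𝕜 := ℂ) m f] with x h1 h2
  rw [Pi.sub_apply, h1, h2, hfc]

theorem trigPoly_single (p : Fin ν → ℤ) : trigPoly (Finsupp.single p 1) = torusChar p := by
  funext x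
  simp [trigPoly]

/-- Reflection fixes characters, so it only conjugates coefficients. Since `X` is real,
`fieldComb_mapRange_conj` matches this on the side of the field. -/
theorem trigPoly_mapRange_conj (c : (Fin ν → ℤ) →₀ ℂ) :
    trigPoly (c.mapRange conj (map_zero _)) = reflectConj (trigPoly c) := by
  funext x
  rw [trigPoly, Finsupp.sum_mapRange_index fun p => by simp, reflectConj, trigPoly, map_finsuppSum]
  refine Finset.sum_congr rfl fun p _ => ?_
  simp only [map_mul]
  rw [← congrFun (reflectConj_torusChar p) x, reflectConj]

end TrigPoly

/-! ### The random spectral measure of a stationary field -/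

section Field

variable {ν d : ℕ} {Ω : Type*} {X : Fin d → (Fin ν → ℤ) → Ω → ℝ}

theorem fieldComb_single (j : Fin d) (p : Fin ν → ℤ) :
    fieldComb X j (Finsupp.single p 1) = fun ω => (X j p ω : ℂ) := by
  funext ω
  simp [fieldComb]

theorem fieldComb_mapRange_conj (j : Fin d) (c : (Fin ν → ℤ) →₀ ℂ) :
    fieldComb X j (c.mapRange conj (map_zero _)) = fun ω => conj (fieldComb X j c ω) := by
  funext ω
  rw [fieldComb, Finsupp.sum_mapRange_index fun p => by simp, fieldComb, map_finsuppSum]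
  refine Finset.sum_congr rfl fun p _ => ?_
  simp only [map_mul, Complex.conj_ofReal]

variable [MeasurableSpace Ω] {P : Measure Ω} {G : MatrixMeasure ν d}

namespace IsStationaryGaussianField

theorem memLp (hX : IsStationaryGaussianField P X) (j : Fin d) (p : Fin ν → ℤ) :
    MemLp (fun ω => (X j p ω : ℂ)) 2 P :=
  (hX.gaussian.hasGaussianLaw_eval (j, p)).memLp_two.ofReal

/-- The spectral representation of the covariances is the Gram identity at characters;
sesquilinearity does the rest. -/
theorem isSpectralIsometry (hX : IsStationaryGaussianField P X) (hG : HasSpectralMeasure P X G) :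
    IsSpectralIsometry P G trigPoly (fieldComb X) where
  posSemidef := hG.1.posSemidef
  memLp_source j c := MemLp.finset_sum_mul c.support c (hG.1.posSemidef.memLp_torusChar j)
  memLp_target j c := MemLp.finset_sum_mul c.support c (hX.memLp j)
  gram j j' a b := by
    have h1 := hG.1.posSemidef.spectralForm_sum a.support b.support a b
      (hG.1.posSemidef.memLp_torusChar j) (hG.1.posSemidef.memLp_torusChar j')
    refine Eq.trans ?_ h1.symm
    have e : (fun ω => fieldComb X j a ω * conj (fieldComb X j' b ω)) = fun ω =>
        ∑ p ∈ a.support, ∑ q ∈ b.support,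
          a p * conj (b q) * ((X j p ω : ℂ) * conj (X j' q ω : ℂ)) := by
      funext ω
      rw [fieldComb, fieldComb, Finsupp.sum, Finsupp.sum, map_sum, Finset.sum_mul_sum]
      refine Finset.sum_congr rfl fun p _ => Finset.sum_congr rfl fun q _ => ?_
      rw [map_mul]
      ring
    have hi : ∀ p q, Integrable
        (fun ω => a p * conj (b q) * ((X j p ω : ℂ) * conj (X j' q ω : ℂ))) P :=
      fun p q => (integrable_mul_conj (hX.memLp j p) (hX.memLp j' q)).const_mul _
    rw [e, integral_finsetSum _ fun p _ => integrable_finsetSum _ fun q _ => hi p q]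
    refine Finset.sum_congr rfl fun p _ => ?_
    rw [integral_finsetSum _ fun q _ => hi p q]
    refine Finset.sum_congr rfl fun q _ => ?_
    rw [integral_const_mul, spectralForm_torusChar, ← hG.2 j j' p q, ← integral_complex_ofReal]
    simp only [Complex.conj_ofReal, Complex.ofReal_mul]
  dense j u hu ε hε := by
    have := hG.1.posSemidef.isFiniteMeasure_diagMeasure j
    exact exists_trigPoly_eLpNorm_sub_lt hu hε

theorem integral_fieldComb [IsProbabilityMeasure P] (hX : IsStationaryGaussianField P X)
    (j : Fin d) (c : (Fin ν → ℤ) →₀ ℂ) : ∫ ω, fieldComb X j c ω ∂P = 0 := by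
  simp only [fieldComb, Finsupp.sum]
  rw [integral_finsetSum _ fun p _ => ((hX.memLp j p).integrable (by norm_num)).const_mul _]
  refine Finset.sum_eq_zero fun p _ => ?_
  rw [integral_const_mul, integral_complex_ofReal, hX.mean_zero]
  simp

theorem isGaussianProcess_fieldComb (hX : IsStationaryGaussianField P X) :
    IsGaussianProcess
      (fun (t : Fin d × ((Fin ν → ℤ) →₀ ℂ)) ω => fieldComb X t.1 t.2 ω) P :=
  isGaussianProcess_of_sum hX.gaussian (fun t => t.2.support) (fun t p => (t.1, p))
    (fun t p => (ContinuousLinearMap.mul ℝ ℂ (t.2 p)).comp Complex.ofRealCLM) fun _ _ => rfl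

theorem isRandomSpectralMeasure_constructedMeasure [IsProbabilityMeasure P]
    (hX : IsStationaryGaussianField P X) (hG : HasSpectralMeasure P X G) :
    IsRandomSpectralMeasure P G (constructedMeasure P G X) where
  gaussian := (hX.isSpectralIsometry hG).isGaussianProcess_l2Extension
    hX.isGaussianProcess_fieldComb
    (fun t : Fin d × {A : Set (Torus ν) // MeasurableSet A} => t.1)
    (fun t => hG.1.posSemidef.memLp_indicator t.1 t.2.2)
  mean_zero j A hA := (hX.isSpectralIsometry hG).integral_l2Extension hX.integral_fieldComb
    (hG.1.posSemidef.memLp_indicator j hA)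
  covariance j j' A B hA hB :=
    ((hX.isSpectralIsometry hG).integral_l2Extension_mul_conj
      (hG.1.posSemidef.memLp_indicator j hA) (hG.1.posSemidef.memLp_indicator j' hB)).trans
      (hG.1.posSemidef.spectralForm_indicator hA hB)
  additive j n A hA hd := by
    -- Additivity is linearity of `T_j`, since indicators of disjoint sets add up to that of the
    -- union.
    have h1 := ((hX.isSpectralIsometry hG).isL2Isometry j).map_sum Finset.univ (fun _ => 1)
      fun s => hG.1.posSemidef.memLp_indicator j (hA s)
    have h2 : (fun x => ∑ s, 1 * (A s).indicator (fun _ => (1 : ℂ)) x) =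
        (⋃ s, A s).indicator fun _ => 1 := by
      funext x
      simp only [one_mul]
      by_cases hx : x ∈ ⋃ s, A s
      · obtain ⟨s, hs⟩ := Set.mem_iUnion.1 hx
        rw [Set.indicator_of_mem hx, Finset.sum_eq_single s]
        · simp [hs]
        · intro t _ hts
          exact Set.indicator_of_notMem (fun ht => Set.disjoint_left.1 (hd hts) ht hs) _
        · simp
      · rw [Set.indicator_of_notMem hx]
        exact Finset.sum_eq_zero fun s _ =>
          Set.indicator_of_notMem (fun hs => hx (Set.mem_iUnion.2 ⟨s, hs⟩)) _
    rw [h2] at h1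
    simp only [one_mul] at h1
    exact h1.symm
  hermitian j A hA := by
    have h1 := (hX.isSpectralIsometry hG).l2Extension_reflectConj hG.1
      (σ := fun c => c.mapRange conj (map_zero _)) trigPoly_mapRange_conj
      (fun j c => Eventually.of_forall fun ω => congrFun (fieldComb_mapRange_conj j c) ω)
      (hG.1.posSemidef.memLp_indicator j hA.neg)
    have h2 : reflectConj ((-A).indicator fun _ => 1) = A.indicator fun _ => (1 : ℂ) := by
      funext x
      by_cases hx : x ∈ A <;> simp [reflectConj, hx]
    rw [h2] at h1
    exact h1

/-- The two maps agree on elementary functions by linearity of `T_j`. If `s_n` approximates `u`,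
then `‖∫ s_n dZ - T_j u‖ = ‖s_n - u‖` tends to 0. -/
theorem randomIntegral_constructedMeasure [IsProbabilityMeasure P]
    (hX : IsStationaryGaussianField P X) (hG : HasSpectralMeasure P X G) (j : Fin d)
    {u : Torus ν → ℂ} (hu : MemLp u 2 (diagMeasure G j)) :
    randomIntegral P G (constructedMeasure P G X) j u =ᵐ[P] spectralOperator P G X j u := by
  have hZ := hX.isRandomSpectralMeasure_constructedMeasure hG
  have hI := hZ.isSpectralIsometry hG.1.posSemidef
  have hT := (hX.isSpectralIsometry hG).isL2Isometry j
  obtain ⟨hm, i, hi, hi'⟩ := (hI.isDenseIsometry j).isL2Extension_l2Extension hu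
  refine ae_eq_of_tendsto_eLpNorm hm (hT.memLp u hu) (fun n => hI.memLp_target j (i n)) hi' ?_
  refine hi.congr fun n => ?_
  have h1 : elementaryIntegral (constructedMeasure P G X) j (i n) =ᵐ[P]
      spectralOperator P G X j (fun x => i n x) := by
    rw [simpleFunc_eq_sum_indicator]
    exact (hT.map_sum (i n).range (fun c => c)
      fun c => hG.1.posSemidef.memLp_indicator j ((i n).measurableSet_fiber c)).symm
  rw [← hT.eLpNorm_sub (hI.memLp_source j (i n)) hu]
  refine (eLpNorm_congr_ae ?_).symm
  filter_upwards [h1] with ω hω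
  rw [hω]
  rfl

theorem randomIntegral_constructedMeasure_torusChar [IsProbabilityMeasure P]
    (hX : IsStationaryGaussianField P X) (hG : HasSpectralMeasure P X G) (j : Fin d)
    (p : Fin ν → ℤ) :
    randomIntegral P G (constructedMeasure P G X) j (torusChar p) =ᵐ[P]
      fun ω => (X j p ω : ℂ) := by
  refine (hX.randomIntegral_constructedMeasure hG j
    (hG.1.posSemidef.memLp_torusChar j p)).trans ?_
  have := ((hX.isSpectralIsometry hG).isDenseIsometry j).l2Extension_apply (Finsupp.single p 1)
  rwa [trigPoly_single, fieldComb_single] at this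

end IsStationaryGaussianField

end Field

end

/-! ### The isonormal Gaussian process of a Hilbert space -/

theorem isGaussianProcess_of_iIndepFun {Ω ι : Type*} [MeasurableSpace Ω] {P : Measure Ω}
    {ξ : ι → Ω → ℝ} (h1 : ∀ i, HasGaussianLaw (ξ i) P) (h2 : iIndepFun ξ P) :
    IsGaussianProcess ξ P where
  hasGaussianLaw I :=
    iIndepFun.hasGaussianLaw (X := fun i : I => ξ i) (fun i => h1 i)
      (h2.precomp Subtype.val_injective)

/-- Every real Hilbert space carries an isonormal Gaussian process. -/
theorem exists_isonormal (H : Type) [NormedAddCommGroup H] [InnerProductSpace ℝ H]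
    [CompleteSpace H] :
    ∃ (Ω : Type) (_ : MeasurableSpace Ω) (P : Measure Ω) (_ : IsProbabilityMeasure P)
      (W : H → Ω → ℝ), IsGaussianProcess W P ∧ (∀ h, ∫ ω, W h ω ∂P = 0) ∧
      (∀ h k, ∫ ω, W h ω * W k ω ∂P = inner ℝ h k) ∧
      ∀ h, W (-h) =ᵐ[P] fun ω => -W h ω := by
  obtain ⟨w, b, -⟩ := exists_hilbertBasis ℝ H
  obtain ⟨Ω, mΩ, P, ξ, hm, hξ, hind, hP⟩ := exists_iid w (gaussianReal 0 1)
  have hg : ∀ i, HasGaussianLaw (ξ i) P := fun i => (hξ i).hasGaussianLaw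
  have hproc := isGaussianProcess_of_iIndepFun hg hind
  have hL : ∀ i, MemLp (ξ i) 2 P := fun i => (hg i).memLp_two
  have h0 : ∀ i, ∫ ω, ξ i ω ∂P = 0 := fun i => by
    rw [(hξ i).integral_eq]
    exact integral_id_gaussianReal
  have horth : Orthonormal ℝ fun i => (hL i).toLp (ξ i) := by
    classical
    rw [orthonormal_iff_ite]
    intro i k
    rw [inner_toLp_eq_integral (hL k) (hL i)]
    simp only [conj_trivial]
    split_ifs with hik
    · subst hik
      have hv : variance (ξ i) P = 1 := by
        rw [(hξ i).variance_eq, variance_id_gaussianReal]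
        simp
      rw [variance_of_integral_eq_zero (hm i).aemeasurable (h0 i)] at hv
      rw [← hv]
      simp only [sq]
    · have := (hind.indepFun (Ne.symm hik)).integral_mul_eq_mul_integral
        (hL k).aestronglyMeasurable (hL i).aestronglyMeasurable
      simpa [h0] using this
  -- The embedding sends the basis vectors to independent standard normal variables, which are
  -- orthonormal in L²(P).
  set U : H →ₗᵢ[ℝ] Lp ℝ 2 P :=
    (horth.orthogonalFamily.linearIsometry).comp b.repr.toLinearIsometry with hU
  have hseq : ∀ h : H, ∃ s : ℕ → Finset w,
      Tendsto (fun n => eLpNorm (fun ω => ∑ i ∈ s n, b.repr h i * ξ i ω - U h ω) 2 P)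
        atTop (𝓝 0) := fun h => by
    have hs := horth.orthogonalFamily.hasSum_linearIsometry (b.repr h)
    -- The basis may be uncountable, so the expansion converges along a net of finite sets; a
    -- sequence is extracted through the closure.
    have hc := mem_closure_of_tendsto (s := Set.range fun s : Finset w =>
      ∑ i ∈ s, b.repr h i • (hL i).toLp (ξ i)) hs (Eventually.of_forall fun s => ⟨s, by simp⟩)
    obtain ⟨x, hx, hxt⟩ := mem_closure_iff_seq_limit.1 hc
    choose s hs using hx
    refine ⟨s, ?_⟩
    rw [Lp.tendsto_Lp_iff_tendsto_eLpNorm'] at hxt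
    refine hxt.congr fun n => eLpNorm_congr_ae ?_
    rw [← hs]
    have h1 := Lp.coeFn_fun_finsetSum (s n) fun i => b.repr h i • (hL i).toLp (ξ i)
    have h2 : ∀ᵐ ω ∂P, ∀ i ∈ s n, (b.repr h i • (hL i).toLp (ξ i) : Lp ℝ 2 P) ω =
        b.repr h i * ξ i ω := (Finset.eventually_all _).2 fun i _ => by
      filter_upwards [Lp.coeFn_smul (b.repr h i) ((hL i).toLp (ξ i)), (hL i).coeFn_toLp] with ω e1 e2
      rw [e1, Pi.smul_apply, e2, smul_eq_mul]
    filter_upwards [h1, h2] with ω e1 e2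
    rw [Pi.sub_apply, e1, Finset.sum_congr rfl e2]
    rfl
  choose s hs using hseq
  have hF : ∀ n, IsGaussianProcess (fun h ω => ∑ i ∈ s h n, b.repr h i * ξ i ω) P := fun n =>
    isGaussianProcess_of_sum hproc (fun h => s h n) (fun _ i => i)
      (fun h i => ContinuousLinearMap.mul ℝ ℝ (b.repr h i)) fun _ _ => rfl
  have hFL : ∀ n h, MemLp (fun ω => ∑ i ∈ s h n, b.repr h i * ξ i ω) 2 P := fun n h =>
    ((hF n).hasGaussianLaw_eval h).memLp_two
  refine ⟨Ω, mΩ, P, hP, fun h => U h, ?_, fun h => ?_, fun h k => ?_, fun h => ?_⟩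
  · exact isGaussianProcess_of_tendsto_eLpNorm (fun h => Lp.memLp (U h)) hF fun h => hs h
  · refine tendsto_nhds_unique (tendsto_integral_of_tendsto_eLpNorm_two (Lp.memLp (U h))
      (fun n => hFL n h) (hs h)) (tendsto_const_nhds.congr fun n => ?_)
    rw [integral_finsetSum _ fun i _ => ((hL i).integrable (by simp)).const_mul _]
    simp [integral_const_mul, h0]
  · have := inner_toLp_eq_integral (Lp.memLp (U k)) (Lp.memLp (U h))
    rw [Lp.toLp_coeFn, Lp.toLp_coeFn, LinearIsometry.inner_map_map] at this
    rw [this]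
    exact integral_congr_ae (Eventually.of_forall fun ω => mul_comm _ _)
  · simp only [map_neg]
    exact Lp.coeFn_neg (U h)

/-! ### Hilbert spaces with a prescribed Gram matrix -/

/-- A positive semidefinite kernel is the Gram matrix of a family in a Hilbert space. -/
theorem exists_hilbert_of_posSemidef_kernel {T : Type} (κ : T → T → ℂ)
    (hκ : ∀ s t, κ t s = conj (κ s t))
    (hpos : ∀ (s : Finset T) (c : T → ℂ), 0 ≤ (∑ x ∈ s, ∑ y ∈ s, c x * conj (c y) * κ x y).re) :
    ∃ (H : Type) (_ : NormedAddCommGroup H) (_ : InnerProductSpace ℂ H) (_ : CompleteSpace H)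
      (z : T → H), ∀ s t, inner ℂ (z s) (z t) = κ s t := by
  -- The scalar kernel is read as an operator valued one on the one-dimensional space `ℂ`; the
  -- vectors sought are the kernel functions of its reproducing kernel space.
  let K : Matrix T T (ℂ →L[ℂ] ℂ) := Matrix.of fun x y => κ x y • 1
  have hK : K.PosSemidef := by
    have hiff := (RKHS.posSemidef_tfae (K := K)).out 0 2
    refine hiff.2 ⟨?_, fun v => ?_⟩
    · ext x y
      simp [K, Matrix.conjTranspose_apply, hκ x y]
    · refine (hpos v.support fun x => conj (v x)).trans_eq ?_
      simp only [Finsupp.sum, RCLike.re_eq_complex_re]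
      congr 1
      refine Finset.sum_congr rfl fun x _ => Finset.sum_congr rfl fun y _ => ?_
      simp [K, hκ x y]
      ring
  have : Fact K.PosSemidef := ⟨hK⟩
  refine ⟨RKHS.OfKernel K, inferInstance, inferInstance, inferInstance,
    fun t => RKHS.kerFun (RKHS.OfKernel K) t 1, fun s t => ?_⟩
  rw [← RKHS.kernel_inner, RKHS.OfKernel.kernel_ofKernel]
  simp [K, hκ t s]

/-! ### Complex Gaussian families with a symmetry -/

/-- A family in a complex Hilbert space with an involution that conjugates the Gram matrix is
represented by a centered complex Gaussian family on which the involution acts by conjugation. -/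
theorem exists_gaussian_of_conj_gram {T H : Type} [NormedAddCommGroup H] [InnerProductSpace ℂ H]
    [CompleteSpace H] (z : T → H) (σ : T → T) (hσ : Function.Involutive σ)
    (hz : ∀ s t, inner ℂ (z (σ s)) (z (σ t)) = conj (inner ℂ (z s) (z t))) :
    ∃ (Ω : Type) (_ : MeasurableSpace Ω) (P : Measure Ω) (_ : IsProbabilityMeasure P)
      (Z : T → Ω → ℂ), IsGaussianProcess Z P ∧ (∀ t, ∫ ω, Z t ω ∂P = 0) ∧
      (∀ s t, ∫ ω, Z s ω * conj (Z t ω) ∂P = inner ℂ (z s) (z t)) ∧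
      ∀ t, Z t =ᵐ[P] fun ω => conj (Z (σ t) ω) := by
  -- `H` becomes a real Hilbert space with the inner product `Re ⟪·,·⟫`.
  let := InnerProductSpace.rclikeToReal ℂ H
  obtain ⟨Ω, mΩ, P, hP, W, hW, h0, hc, hn⟩ := exists_isonormal H
  -- With `Z = (W(x) + iW(y))/2` the required symmetry is immediate: `σ` fixes `x` and negates `y`.
  -- The factor `i` in `y` lets real inner products of `x` with `y` see the imaginary part of the
  -- Gram matrix.
  set x : T → H := fun t => z t + z (σ t) with hx
  set y : T → H := fun t => Complex.I • (z t - z (σ t)) with hy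
  have hL : ∀ h, MemLp (W h) 2 P := fun h => (hW.hasGaussianLaw_eval h).memLp_two
  have hint : ∀ h k, Integrable (fun ω => ((W h ω * W k ω : ℝ) : ℂ)) P := fun h k =>
    ((hL h).integrable_mul (hL k)).ofReal
  have hi : ∀ h, Integrable (fun ω => (W h ω : ℂ)) P := fun h =>
    ((hL h).integrable (by simp)).ofReal
  refine ⟨Ω, mΩ, P, hP, fun t ω => (W (x t) ω + Complex.I * W (y t) ω) / 2, ?_, fun t => ?_,
    fun s t => ?_, fun t => ?_⟩
  · refine isGaussianProcess_of_sum hW (fun _ => (Finset.univ : Finset (Fin 2)))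
      (fun t i => ![x t, y t] i)
      (fun _ i => (ContinuousLinearMap.mul ℝ ℂ (![1 / 2, Complex.I / 2] i)).comp
        Complex.ofRealCLM) fun t ω => ?_
    simp
    ring
  · rw [integral_div, integral_add (hi _) ((hi _).const_mul _), integral_const_mul,
      integral_complex_ofReal, integral_complex_ofReal, h0, h0]
    simp
  · have e : ∀ ω, (W (x s) ω + Complex.I * W (y s) ω) / 2 *
        conj (((W (x t) ω : ℂ) + Complex.I * W (y t) ω) / 2) =
        (((W (x s) ω * W (x t) ω : ℝ) : ℂ) + ((W (y s) ω * W (y t) ω : ℝ) : ℂ) +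
          Complex.I * (((W (y s) ω * W (x t) ω : ℝ) : ℂ) - ((W (x s) ω * W (y t) ω : ℝ) : ℂ))) / 4 :=
      fun ω => by
        simp only [map_div₀, map_add, map_mul, Complex.conj_ofReal, Complex.conj_I, map_ofNat]
        push_cast
        linear_combination (-(W (y s) ω : ℂ) * W (y t) ω / 4) * Complex.I_sq
    simp only [e]
    have h1 : Integrable (fun ω => ((W (x s) ω * W (x t) ω : ℝ) : ℂ) +
        ((W (y s) ω * W (y t) ω : ℝ) : ℂ)) P := (hint _ _).add (hint _ _)
    have h2 : Integrable (fun ω => ((W (y s) ω * W (x t) ω : ℝ) : ℂ) -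
        ((W (x s) ω * W (y t) ω : ℝ) : ℂ)) P := (hint _ _).sub (hint _ _)
    rw [integral_div, integral_add h1 (h2.const_mul _), integral_add (hint _ _) (hint _ _),
      integral_const_mul, integral_sub (hint _ _) (hint _ _)]
    simp only [integral_complex_ofReal, hc]
    -- The mixed terms `⟪z s, z (σ t)⟫` cancel; `hz` identifies the two remaining kinds, giving four
    -- times the real and imaginary parts.
    simp only [real_inner_eq_re_inner ℂ, hx, hy, inner_add_left, inner_add_right, inner_sub_left,
      inner_sub_right, inner_smul_left, inner_smul_right, hz s t, RCLike.re_eq_complex_re]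
    apply Complex.ext
    · simp [-inner_conj_symm]
      ring
    · simp [-inner_conj_symm]
      ring
  · have hyt : y (σ t) = -y t := by
      simp only [hy, hσ t, ← smul_neg, neg_sub]
    have hxt : x (σ t) = x t := by
      simp only [hx, hσ t, add_comm]
    filter_upwards [hn (y t)] with ω hω
    rw [hxt, hyt, hω]
    simp [map_ofNat]

/-! ### Existence of the random spectral measure -/

theorem IsSpectralDensity.apply_swap {ν d : ℕ} {G : MatrixMeasure ν d} {μ : Measure (Torus ν)}
    {g : Fin d → Fin d → Torus ν → ℂ} (h : IsSpectralDensity G μ g) (j j' : Fin d)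
    {A : Set (Torus ν)} (hA : MeasurableSet A) : G j' j A = conj (G j j' A) := by
  rw [h.eq_withDensityᵥ, h.eq_withDensityᵥ, withDensityᵥ_apply (h.integrable _ _) hA,
    withDensityᵥ_apply (h.integrable _ _) hA, ← integral_conj]
  refine setIntegral_congr_ae hA ?_
  filter_upwards [h.posSemidef] with x hx _
  have := hx.isHermitian.apply j' j
  simpa using this.symm

/-- The sum is the integral of the quadratic form of the density matrix at the vector `conj (c x * u
x τ)`, nonnegative pointwise. Indices `j x` may repeat, hence the submatrix. -/
theorem IsSpectralDensity.re_sum_nonneg {ν d : ℕ} {G : MatrixMeasure ν d} {μ : Measure (Torus ν)}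
    {g : Fin d → Fin d → Torus ν → ℂ} (h : IsSpectralDensity G μ g) {T : Type*} (s : Finset T)
    (c : T → ℂ) (j : T → Fin d) {u : T → Torus ν → ℂ}
    (hu : ∀ t, MemLp (u t) 2 (diagMeasure G (j t))) :
    0 ≤ (∑ x ∈ s, ∑ y ∈ s, c x * conj (c y) * spectralForm G (j x) (j y) (u x) (u y)).re := by
  have hi : ∀ x y, Integrable (fun τ => c x * conj (c y) *
      (u x τ * conj (u y τ) * g (j x) (j y) τ)) μ := fun x y =>
    (h.integrable_mul_conj_mul (hu x) (hu y)).const_mul _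
  have e : ∑ x ∈ s, ∑ y ∈ s, c x * conj (c y) * spectralForm G (j x) (j y) (u x) (u y) =
      ∫ τ, ∑ x ∈ s, ∑ y ∈ s, c x * conj (c y) * (u x τ * conj (u y τ) * g (j x) (j y) τ) ∂μ := by
    rw [integral_finsetSum _ fun x _ => integrable_finsetSum _ fun y _ => hi x y]
    refine Finset.sum_congr rfl fun x _ => ?_
    rw [integral_finsetSum _ fun y _ => hi x y]
    refine Finset.sum_congr rfl fun y _ => ?_
    rw [integral_const_mul, spectralForm, h.cintegral_eq (hu x) (hu y)]
  rw [e]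
  refine (Complex.nonneg_iff.1 (integral_nonneg_of_ae ?_)).1
  filter_upwards [h.posSemidef] with τ hτ
  have := (hτ.submatrix fun x : s => j x).dotProduct_mulVec_nonneg
    fun x : s => conj (c x * u x τ)
  refine this.trans_eq ?_
  simp only [dotProduct, Matrix.mulVec, Pi.star_apply, RCLike.star_def, Complex.conj_conj,
    Matrix.submatrix_apply, Matrix.of_apply, Finset.mul_sum]
  rw [← Finset.sum_coe_sort s]
  refine Finset.sum_congr rfl fun x _ => ?_
  rw [← Finset.sum_coe_sort s]
  refine Finset.sum_congr rfl fun y _ => ?_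
  rw [map_mul]
  ring

/-- Finite additivity of a random set function follows from its covariances. -/
theorem ae_sum_eq_of_covariance {ν d : ℕ} {G : MatrixMeasure ν d} (hG : IsPosSemidefMeasure G)
    {Ω : Type*} [MeasurableSpace Ω] {P : Measure Ω} (j : Fin d) {Z : Set (Torus ν) → Ω → ℂ}
    (hL : ∀ A, MeasurableSet A → MemLp (Z A) 2 P)
    (hZ : ∀ A B, MeasurableSet A → MeasurableSet B →
      ∫ ω, Z A ω * conj (Z B ω) ∂P = G j j (A ∩ B))
    {n : ℕ} {A : Fin n → Set (Torus ν)} (hA : ∀ s, MeasurableSet (A s))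
    (hd : Pairwise fun s t => Disjoint (A s) (A t)) :
    (fun ω => ∑ s, Z (A s) ω) =ᵐ[P] Z (⋃ s, A s) := by
  -- The union joins the family as the index `none` with coefficient -1; by disjointness the
  -- corresponding combination of indicators is zero.
  set B : Option (Fin n) → Set (Torus ν) := fun o => o.elim (⋃ s, A s) A with hB
  have hBm : ∀ o, MeasurableSet (B o) := fun o => by
    cases o
    exacts [MeasurableSet.iUnion hA, hA _]
  have key := eLpNorm_sum_eq_of_gram Finset.univ (fun o : Option (Fin n) => o.elim (-1) fun _ => 1)
    (fun o => hG.memLp_indicator j (hBm o)) (fun o => hL _ (hBm o)) fun o p => by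
      rw [hZ _ _ (hBm o) (hBm p), ← hG.spectralForm_self (hG.memLp_indicator j (hBm o))
        (hG.memLp_indicator j (hBm p)), hG.spectralForm_indicator (hBm o) (hBm p)]
  refine ae_eq_of_eLpNorm_sub_eq_zero (memLp_finsetSum _ fun s _ => hL _ (hA s))
    (hL _ (MeasurableSet.iUnion hA)) ?_
  have h0 : (fun x => ∑ o : Option (Fin n), (o.elim (-1) fun _ => 1) *
      (B o).indicator (fun _ => (1 : ℂ)) x) = fun _ => 0 := by
    funext x
    simp only [Fintype.sum_option, hB, Option.elim]
    by_cases hx : x ∈ ⋃ s, A s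
    · obtain ⟨s, hs⟩ := Set.mem_iUnion.1 hx
      rw [Finset.sum_eq_single s (fun t _ hts => by
        rw [Set.indicator_of_notMem ((Set.disjoint_left.1 (hd hts.symm)) hs), mul_zero]) (by simp)]
      simp [hx, hs]
    · have hx' : ∀ s, x ∉ A s := fun s hs => hx (Set.mem_iUnion.2 ⟨s, hs⟩)
      simp [hx, hx']
  rw [h0] at key
  simp only [Fintype.sum_option, hB, Option.elim] at key
  rw [eLpNorm_zero'] at key
  rw [← key]
  congr 1
  funext ω
  simp only [one_mul]
  ring

/-- A vector valued random spectral measure corresponding to `G` exists. -/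
theorem IsMatrixSpectralMeasure.exists_randomSpectralMeasure {ν d : ℕ} {G : MatrixMeasure ν d}
    (hG : IsMatrixSpectralMeasure G) :
    ∃ (Ω : Type) (_ : MeasurableSpace Ω) (P : Measure Ω) (_ : IsProbabilityMeasure P)
      (Z : Fin d → Set (Torus ν) → Ω → ℂ), IsRandomSpectralMeasure P G Z := by
  classical
  obtain ⟨μ, g, h⟩ := hG.posSemidef.exists_density
  let T : Type := Fin d × {A : Set (Torus ν) // MeasurableSet A}
  obtain ⟨H, _, _, _, z, hz⟩ := exists_hilbert_of_posSemidef_kernel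
    (fun s t : T => G s.1 t.1 (s.2.1 ∩ t.2.1))
    (fun s t => by rw [Set.inter_comm, h.apply_swap s.1 t.1 (s.2.2.inter t.2.2)])
    (fun s c => by
      have := h.re_sum_nonneg s c Prod.fst fun t => hG.posSemidef.memLp_indicator t.1 t.2.2
      simpa only [hG.posSemidef.spectralForm_indicator (Subtype.property _)
        (Subtype.property _)] using this)
  -- Reflection of the set; evenness of `G` says precisely that it conjugates the Gram matrix.
  let σ : T → T := fun t => (t.1, ⟨-t.2.1, t.2.2.neg⟩)
  obtain ⟨Ω, mΩ, P, hP, Z, hgauss, h0, hcov, hsymm⟩ := exists_gaussian_of_conj_gram z σ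
    (fun t => by simp [σ])
    (fun s t => by
      rw [hz, hz, ← hG.even s.1 t.1 _ (s.2.2.inter t.2.2)]
      simp [σ, Set.inter_neg])
  have hL : ∀ t, MemLp (Z t) 2 P := fun t => (hgauss.hasGaussianLaw_eval t).memLp_two
  let Y : Fin d → Set (Torus ν) → Ω → ℂ := fun j A =>
    if hA : MeasurableSet A then Z (j, ⟨A, hA⟩) else 0
  have hY : ∀ j A (hA : MeasurableSet A), Y j A = Z (j, ⟨A, hA⟩) := fun j A hA => dif_pos hA
  have hYcov : ∀ j j' A B, MeasurableSet A → MeasurableSet B →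
      ∫ ω, Y j A ω * conj (Y j' B ω) ∂P = G j j' (A ∩ B) := fun j j' A B hA hB => by
    rw [hY j A hA, hY j' B hB, hcov, hz]
  refine ⟨Ω, mΩ, P, hP, Y, ?_, fun j A hA => ?_, hYcov, fun j n A hA hd => ?_, fun j A hA => ?_⟩
  · have : (fun (t : T) ω => Y t.1 t.2.1 ω) = Z := by
      funext t
      exact hY _ _ t.2.2
    rw [this]
    exact hgauss
  · rw [hY j A hA, h0]
  · exact ae_sum_eq_of_covariance hG.posSemidef j (fun A hA => by rw [hY j A hA]; exact hL _)
      (hYcov j j) hA hd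
  · rw [hY j A hA, hY j (-A) hA.neg]
    exact hsymm _

end SpectralField

/-! ### Assembly of the three assertions. -/

theorem theorem3p1 (ν d : ℕ) (G : MatrixMeasure ν d) (hG : IsMatrixSpectralMeasure G) :
    -- a random spectral measure corresponding to `G` exists
    (∃ (Ω : Type) (_ : MeasurableSpace Ω) (P : Measure Ω) (_ : IsProbabilityMeasure P)
      (Z : Fin d → Set (Torus ν) → Ω → ℂ), IsRandomSpectralMeasure P G Z) ∧
    -- the random integral with respect to any such random spectral measure
    (∀ (Ω : Type*) [MeasurableSpace Ω] (P : Measure Ω) [IsProbabilityMeasure P]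
      (Z : Fin d → Set (Torus ν) → Ω → ℂ), IsRandomSpectralMeasure P G Z →
      -- it is well defined, has finite second moment,
      -- and takes the prescribed values at elementary functions
      (∀ j, L2ExtensionWellDefined (diagMeasure G j) P
        (fun (s : SimpleFunc (Torus ν) ℂ) x => s x) (elementaryIntegral Z j)) ∧
      (∀ j u, MemLp u 2 (diagMeasure G j) → MemLp (randomIntegral P G Z j u) 2 P) ∧
      (∀ (j : Fin d) (n : ℕ) (c : Fin n → ℂ) (A : Fin n → Set (Torus ν)),
        (∀ s, MeasurableSet (A s)) → Pairwise (fun s t => Disjoint (A s) (A t)) →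
        randomIntegral P G Z j (fun x => ∑ s, (A s).indicator (fun _ => c s) x) =ᵐ[P]
          fun ω => ∑ s, c s * Z j (A s) ω) ∧
      -- it is linear
      (∀ (j : Fin d) (a b : ℂ) (u v : Torus ν → ℂ),
        MemLp u 2 (diagMeasure G j) → MemLp v 2 (diagMeasure G j) →
        randomIntegral P G Z j (fun x => a * u x + b * v x) =ᵐ[P]
          fun ω => a * randomIntegral P G Z j u ω + b * randomIntegral P G Z j v ω) ∧
      -- covariance formula
      (∀ (j j' : Fin d) (u v : Torus ν → ℂ),
        MemLp u 2 (diagMeasure G j) → MemLp v 2 (diagMeasure G j') →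
        (G j j').Integrable (fun x => u x * conj (v x)) ∧
        ∫ ω, randomIntegral P G Z j u ω * conj (randomIntegral P G Z j' v ω) ∂P =
          cintegral (G j j') (fun x => u x * conj (v x))) ∧
      -- mean zero
      (∀ j u, MemLp u 2 (diagMeasure G j) → ∫ ω, randomIntegral P G Z j u ω ∂P = 0) ∧
      -- real values at Hermitian symmetric integrands
      (∀ j u, MemLp u 2 (diagMeasure G j) →
        (∀ᵐ x ∂(diagMeasure G j), u (-x) = conj (u x)) →
        ∀ᵐ ω ∂P, (randomIntegral P G Z j u ω).im = 0) ∧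
      -- the integrals of the characters form a real stationary Gaussian field
      -- with spectral measure `G`
      (∀ j p, ∀ᵐ ω ∂P, (randomIntegral P G Z j (torusChar p) ω).im = 0) ∧
      IsStationaryGaussianField P (fun j p ω => (randomIntegral P G Z j (torusChar p) ω).re) ∧
      HasSpectralMeasure P (fun j p ω => (randomIntegral P G Z j (torusChar p) ω).re) G) ∧
    -- every field with spectral measure `G` is recovered from the random spectral measure
    -- constructed from it
    (∀ (Ω : Type*) [MeasurableSpace Ω] (P : Measure Ω) [IsProbabilityMeasure P]
      (X : Fin d → (Fin ν → ℤ) → Ω → ℝ),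
      IsStationaryGaussianField P X → HasSpectralMeasure P X G →
      (∀ j, L2ExtensionWellDefined (diagMeasure G j) P trigPoly (fieldComb X j)) ∧
      IsRandomSpectralMeasure P G (constructedMeasure P G X) ∧
      ∀ j p, randomIntegral P G (constructedMeasure P G X) j (torusChar p) =ᵐ[P]
        fun ω => (X j p ω : ℂ)) := by
  refine ⟨hG.exists_randomSpectralMeasure, fun Ω _ P _ Z hZ => ?_, fun Ω _ P _ X hX hXG => ?_⟩
  · have hI := hZ.isSpectralIsometry hG.posSemidef
    exact ⟨fun j => (hI.isDenseIsometry j).wellDefined,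
      fun j u hu => (hI.isDenseIsometry j).memLp_l2Extension hu,
      fun j n c A hA _ => hZ.randomIntegral_elementary hG.posSemidef j n c A hA,
      fun j a b u v hu hv => (hI.isL2Isometry j).map_linearComb a b hu hv,
      fun j j' u v hu hv => ⟨hG.posSemidef.integrable_mul_conj hu hv,
        hI.integral_l2Extension_mul_conj hu hv⟩,
      fun j u hu => hI.integral_l2Extension hZ.integral_elementaryIntegral hu,
      fun j u hu h => hZ.randomIntegral_im_eq_zero hG hu h,
      fun j p => hZ.randomIntegral_torusChar_im hG j p,
      hZ.isStationaryGaussianField hG, hG, hZ.integral_re_mul_re hG⟩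
  · exact ⟨fun j => ((hX.isSpectralIsometry hXG).isDenseIsometry j).wellDefined,
      hX.isRandomSpectralMeasure_constructedMeasure hXG,
      hX.randomIntegral_constructedMeasure_torusChar hXG⟩
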